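/- \textbf{Conventions.} Manifolds are smooth, pure-dimensional, Hausdorff, second countable and without boundary (not necessarily connected); metrics and functions are smooth. Let $(M,g)$ be a Riemannian manifold of dimension $n\ge 3$ with volume measure $\mu_g$ and scalar curvature $\mathrm{scal}_g$; put $p=\frac{2n}{n-2}$, $a_n=\frac{4(n-1)}{n-2}$. For a nonempty open set $U\subseteq M$, the Yamabe constant of (the restriction of $g$ to) $U$ is \[ Y_U(g)=\inf\left\{\frac{1}{\|v\|_{L^p(g)}^2}\int_U\bigl(a_n|dv|_g^2+\mathrm{scal}_g\,v^2\bigr)\,d\mu_g \;:\; v\in C_c^\infty(U,\mathbb R_{\ge 0})\setminus\{0\}\right\}\in\mathbb R\cup\{-\infty\}. \] If $M$ is noncompact, the Yamabe constant at infinity is $Y^\infty_M(g)=\lim_{i\to\infty}Y_{M\setminus K_i}(g)$, where $(K_i)_{i\in\mathbb N}$ is a compact exhaustion of $M$, i.e. a sequence of compact sets with $K_i\subseteq \operatorname{int} K_{i+1}$ and $\bigcup_i K_i=M$; the limit exists and does not depend on the exhaustion. For a function $f$, write $f_-=-\min\{0,f\}$. \textbf{Theorem.} Every Riemannian metric $g$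 on a noncompact manifold $M$ of dimension $n\ge 3$ satisfies: \begin{enumerate} \item $-\|(\mathrm{scal}_g)_-\|_{L^{n/2}(g)}\le Y_M(g)\le Y^\infty_M(g)$, where the norm takes values in $[0,\infty]$; \item if $Y^\infty_M(g)<0$, then $Y^\infty_M(g)=-\infty$; \item if $Y_M(g)=-\infty$, then $Y^\infty_M(g)=-\infty$. \end{enumerate} -/

import Mathlib

open Set Filter Topology MeasureTheory Bundle
open scoped Manifold ContDiff ENNReal

noncomputable section

namespace Yamabe

/-- A smooth Riemannian metric on the `n`-manifold `M` (without boundary). -/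
abbrev Metric (n : ℕ) (M : Type*) [TopologicalSpace M]
    [ChartedSpace (EuclideanSpace ℝ (Fin n)) M] [IsManifold (𝓡 n) ∞ M] :=
  ContMDiffRiemannianMetric (𝓡 n) ∞ (EuclideanSpace ℝ (Fin n))
    (fun x : M => TangentSpace (𝓡 n) x)

/-! ### Scalar curvature of a matrix-valued function on coordinate space -/

section Coordinates

variable {n : ℕ}

/-- The partial derivative `∂ₖ f` at `y`. -/
def partialDeriv (k : Fin n) (f : EuclideanSpace ℝ (Fin n) → ℝ)
    (y : EuclideanSpace ℝ (Fin n)) : ℝ :=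
  fderiv ℝ f y (EuclideanSpace.single k 1)

/-- The Christoffel symbol
`Γˡᵢⱼ = ½ ∑ₘ Gˡᵐ (∂ᵢ Gⱼₘ + ∂ⱼ Gᵢₘ - ∂ₘ Gᵢⱼ)`. -/
def christoffel (G : EuclideanSpace ℝ (Fin n) → Matrix (Fin n) (Fin n) ℝ)
    (l i j : Fin n) (y : EuclideanSpace ℝ (Fin n)) : ℝ :=
  (1 / 2) * ∑ m, (G y)⁻¹ l m *
    (partialDeriv i (fun z => G z j m) y + partialDeriv j (fun z => G z i m) y
      - partialDeriv m (fun z => G z i j) y)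

/-- The Ricci curvature
`Ricⱼₖ = ∑ᵢ (∂ᵢ Γⁱⱼₖ - ∂ⱼ Γⁱᵢₖ) + ∑ᵢₘ (Γⁱᵢₘ Γᵐⱼₖ - Γⁱⱼₘ Γᵐᵢₖ)`. -/
def coordRicci (G : EuclideanSpace ℝ (Fin n) → Matrix (Fin n) (Fin n) ℝ)
    (j k : Fin n) (y : EuclideanSpace ℝ (Fin n)) : ℝ :=
  ∑ i, (partialDeriv i (christoffel G i j k) y - partialDeriv j (christoffel G i i k) y)
    + ∑ i, ∑ m, (christoffel G i i m y * christoffel G m j k y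
        - christoffel G i j m y * christoffel G m i k y)

/-- The scalar curvature `∑ⱼₖ Gʲᵏ Ricⱼₖ`. -/
def coordScal (G : EuclideanSpace ℝ (Fin n) → Matrix (Fin n) (Fin n) ℝ)
    (y : EuclideanSpace ℝ (Fin n)) : ℝ :=
  ∑ j, ∑ k, (G y)⁻¹ j k * coordRicci G j k y

end Coordinates

/-! ### Riemannian geometry of `(M, g)` -/

section Manifold

variable {n : ℕ} {M : Type*} [TopologicalSpace M]
  [ChartedSpace (EuclideanSpace ℝ (Fin n)) M] [IsManifold (𝓡 n) ∞ M]

/-- The components `gᵢⱼ = g (∂ᵢ, ∂ⱼ)` of the metric in the chart `e`, as functions of the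
coordinates `y ∈ e.target`. -/
def chartGram (g : Metric n M) (e : OpenPartialHomeomorph M (EuclideanSpace ℝ (Fin n)))
    (y : EuclideanSpace ℝ (Fin n)) : Matrix (Fin n) (Fin n) ℝ :=
  Matrix.of fun i j =>
    g.inner (e.symm y)
      (mfderiv (𝓡 n) (𝓡 n) e.symm y (EuclideanSpace.single i (1 : ℝ)))
      (mfderiv (𝓡 n) (𝓡 n) e.symm y (EuclideanSpace.single j (1 : ℝ)))

/-- The scalar curvature of `g` at `x`, computed in the preferred chart at `x`
(its value does not depend on the chart). -/
def scal (g : Metric n M) (x : M) : ℝ :=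
  coordScal (chartGram g (chartAt (EuclideanSpace ℝ (Fin n)) x))
    (chartAt (EuclideanSpace ℝ (Fin n)) x x)

/-- The measure `√(det gᵢⱼ) dy` on the domain of the chart `e`, as a measure on `M` which vanishes
outside `e.source`. -/
def chartVolume [MeasurableSpace M] (g : Metric n M)
    (e : OpenPartialHomeomorph M (EuclideanSpace ℝ (Fin n))) : Measure M :=
  ((volume.restrict e.target).withDensity
    (fun y => ENNReal.ofReal (Real.sqrt (chartGram g e y).det))).map e.symm

/-- The Riemannian volume measure `μ_g`. The chart measures `√(det gᵢⱼ) dy` coincide on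
overlaps of chart domains, so their supremum is the measure which restricts to each of them on its
chart domain. -/
def riemannianVolume [MeasurableSpace M] (g : Metric n M) : Measure M :=
  ⨆ x : M, chartVolume g (chartAt (EuclideanSpace ℝ (Fin n)) x)

/-- `|dv|_g (x)`: the norm of the differential of `v` at `x`, as a linear form on the
Euclidean vector space `(T_x M, g_x)`. -/
def normDiff (g : Metric n M) (v : M → ℝ) (x : M) : ℝ :=
  letI : RiemannianBundle (fun x : M => TangentSpace (𝓡 n) x) := ⟨g.toRiemannianMetric⟩
  letI dv : TangentSpace (𝓡 n) x →L[ℝ] ℝ := mfderiv (𝓡 n) 𝓘(ℝ, ℝ) v x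
  ‖dv‖

/-- The function `(scal_g)₋ = - min {0, scal_g}`. -/
def scalNeg (g : Metric n M) (x : M) : ℝ := - min 0 (scal g x)

/-! ### Yamabe constants -/

/-- The Yamabe functional
`E_g(v) = ‖v‖_{L^p(g)}⁻² ∫_M (aₙ |dv|_g² + scal_g v²) dμ_g`,
where `p = 2n/(n-2)` and `aₙ = 4(n-1)/(n-2)`. -/
def functional [MeasurableSpace M] (g : Metric n M) (v : M → ℝ) : ℝ :=
  (∫ x, (4 * ((n : ℝ) - 1) / ((n : ℝ) - 2) * normDiff g v x ^ 2 + scal g x * v x ^ 2)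
      ∂(riemannianVolume g)) /
    (eLpNorm v (ENNReal.ofReal (2 * (n : ℝ) / ((n : ℝ) - 2))) (riemannianVolume g)).toReal ^ 2

variable (n) in
/-- Nonnegative, not identically vanishing smooth functions with compact support in `U`. For open
`U`, these are the elements of `C_c^∞(U, ℝ_{≥0}) ∖ {0}`, extended by zero to `M`. -/
structure IsTestFunction (U : Set M) (v : M → ℝ) : Prop where
  smooth : ContMDiff (𝓡 n) 𝓘(ℝ, ℝ) ∞ v
  hasCompactSupport : HasCompactSupport v
  tsupport_subset : tsupport v ⊆ U
  nonneg : ∀ x, 0 ≤ v x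
  ne_zero : v ≠ 0

/-- The Yamabe constant `Y_U(g)` of the restriction of `g` to the open subset `U` of `M`. -/
def yamabeConstantOn [MeasurableSpace M] (g : Metric n M) (U : Set M) : EReal :=
  ⨅ (v : M → ℝ) (_ : IsTestFunction n U v), (functional g v : EReal)

/-- The Yamabe constant `Y_M(g)`. -/
def yamabeConstant [MeasurableSpace M] (g : Metric n M) : EReal :=
  yamabeConstantOn g univ

/-- The Yamabe constant at infinity `lim_{i → ∞} Y_{M ∖ Kᵢ}(g)`, for a compact exhaustion
`(Kᵢ)` of `M`. -/
def yamabeConstantAtInfinity [MeasurableSpace M] (g : Metric n M) (K : CompactExhaustion M) :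
    EReal :=
  limUnder atTop fun i => yamabeConstantOn g (K i)ᶜ

theorem yamabeConstantOn_anti [MeasurableSpace M] (g : Metric n M) {U V : Set M} (h : U ⊆ V) :
    yamabeConstantOn g V ≤ yamabeConstantOn g U :=
  le_iInf₂ fun v hv => iInf₂_le v
    ⟨hv.smooth, hv.hasCompactSupport, hv.tsupport_subset.trans h, hv.nonneg, hv.ne_zero⟩

theorem monotone_yamabeConstantOn_compl [MeasurableSpace M] (g : Metric n M)
    (K : CompactExhaustion M) : Monotone fun i => yamabeConstantOn g (K i)ᶜ :=
  fun _ _ h => yamabeConstantOn_anti g (compl_subset_compl.2 (K.subset h))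

/-- The limit in the definition of the Yamabe constant at infinity exists. -/
theorem tendsto_yamabeConstantAtInfinity [MeasurableSpace M] (g : Metric n M)
    (K : CompactExhaustion M) :
    Tendsto (fun i => yamabeConstantOn g (K i)ᶜ) atTop (𝓝 (yamabeConstantAtInfinity g K)) :=
  tendsto_nhds_limUnder ⟨_, tendsto_atTop_iSup (monotone_yamabeConstantOn_compl g K)⟩

/-- The Yamabe constant at infinity does not depend on the compact exhaustion. -/
theorem yamabeConstantAtInfinity_eq [MeasurableSpace M] (g : Metric n M)
    (K L : CompactExhaustion M) :
    yamabeConstantAtInfinity g K = yamabeConstantAtInfinity g L := by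
  have key : ∀ K L : CompactExhaustion M,
      yamabeConstantAtInfinity g K ≤ yamabeConstantAtInfinity g L := by
    intro K L
    refine le_of_tendsto' (tendsto_yamabeConstantAtInfinity g K) fun i => ?_
    obtain ⟨j, hj⟩ := L.exists_superset_of_isCompact (K.isCompact i)
    exact (yamabeConstantOn_anti g (compl_subset_compl.2 hj)).trans
      ((monotone_yamabeConstantOn_compl g L).ge_of_tendsto
        (tendsto_yamabeConstantAtInfinity g L) j)
  exact le_antisymm (key K L) (key L K)

end Manifold

end Yamabe

end

/-! The curvature and the volume are defined through preferred charts and a supremum of measures.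
The geometric input is that these behave as expected: `scal` and `|dv|²` are continuous, and the
volume is locally finite. Compactly supported integrands are then integrable, and the rest is soft
analysis.

For the lower bound, drop the gradient term, use `scal ≥ -scal₋`, and apply Hölder with `2/n + 2/p =
1` (`integral_mul_sq_le`). The upper bound holds because a smaller open set has fewer test
functions.

If the constant at infinity is below some `-c < 0`, then outside every compact set there is a test
function of energy at most `-c` and `Lᵖ` norm `1`. The sum of `N` such functions with disjoint
supports has energy at most `-cN` and squared norm `N^((n-2)/n)`. The quotient is at most `-c
N^(2/n)`, which is unbounded below (`exists_functional_lt`).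

For the last claim, suppose that the constant at infinity is not `-∞`. By the previous step it is
nonnegative, so the functional is at least `-1` on test functions supported outside some compact set
`Kᵢ`. Take `F` smooth with compact support, values in `[0, π/2]` and `F = π/2` near `Kᵢ`, and split
`v` into `sin F · v` and `cos F · v`. The two energies add up to that of `v` plus `aₙ ∫ |dF|² v²`
(`energy_eq_sin_add_cos`). The cosine part lives outside `Kᵢ`. The sine part and the error carry
compactly supported weights, which Hölder bounds by multiples of `‖v‖²`. Hence the Yamabe constant
is finite from below (`exists_bound_of_exterior_bound`). -/

noncomputable section

namespace Yamabe

open scoped Matrix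

/-! ### Connection forms and their curvature under a change of variables -/

section Curvature

variable {E : Type*} [NormedAddCommGroup E] [NormedSpace ℝ E]

/-- `Γ` is the Levi-Civita connection form at `y` of the family of bilinear forms `g`. -/
def IsLeviCivitaAt (g : E → E →L[ℝ] E →L[ℝ] ℝ) (Γ : E →L[ℝ] E →L[ℝ] E) (y : E) : Prop :=
  ∀ u v w, 2 * g y (Γ u v) w = fderiv ℝ g y u v w + fderiv ℝ g y v u w - fderiv ℝ g y w u v

theorem fderiv_clm_apply₂ {F G H : Type*} [NormedAddCommGroup F] [NormedSpace ℝ F]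
    [NormedAddCommGroup G] [NormedSpace ℝ G] [NormedAddCommGroup H] [NormedSpace ℝ H]
    {B : E → F →L[ℝ] G →L[ℝ] H} {y : E} (hB : DifferentiableAt ℝ B y) (w : E) (u : F) (v : G) :
    fderiv ℝ (fun z => B z u v) y w = fderiv ℝ B y w u v := by
  have h := (hB.hasFDerivAt.clm_apply (hasFDerivAt_const u y)).clm_apply (hasFDerivAt_const v y)
  rw [h.fderiv]; simp

theorem fderiv_pullback {H : Type*} [NormedAddCommGroup H] [NormedSpace ℝ H]
    {B : E → E →L[ℝ] E →L[ℝ] H} {φ : E → E} {y : E}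
    (hφ : ContDiffAt ℝ 2 φ y) (hB : DifferentiableAt ℝ B (φ y)) (w u v : E) :
    fderiv ℝ (fun z => B (φ z) (fderiv ℝ φ z u) (fderiv ℝ φ z v)) y w =
      fderiv ℝ B (φ y) (fderiv ℝ φ y w) (fderiv ℝ φ y u) (fderiv ℝ φ y v)
      + B (φ y) (fderiv ℝ (fderiv ℝ φ) y w u) (fderiv ℝ φ y v)
      + B (φ y) (fderiv ℝ φ y u) (fderiv ℝ (fderiv ℝ φ) y w v) := by
  have h1 : DifferentiableAt ℝ φ y := hφ.differentiableAt (by simp)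
  have h2 : DifferentiableAt ℝ (fderiv ℝ φ) y :=
    (hφ.fderiv_right (m := 1) (by norm_num)).differentiableAt (by simp)
  have h0 : HasFDerivAt (fun z => B (φ z)) ((fderiv ℝ B (φ y)).comp (fderiv ℝ φ y)) y :=
    HasFDerivAt.comp (G := E →L[ℝ] E →L[ℝ] H) y hB.hasFDerivAt h1.hasFDerivAt
  have hu := h2.hasFDerivAt.clm_apply (hasFDerivAt_const u y)
  have hv := h2.hasFDerivAt.clm_apply (hasFDerivAt_const v y)
  rw [((h0.clm_apply hu).clm_apply hv).fderiv]
  simp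
  abel

theorem fderiv_fderiv_symm {F : Type*} [NormedAddCommGroup F] [NormedSpace ℝ F] {φ : E → F} {y : E}
    (hφ : ContDiffAt ℝ 2 φ y) (u v : E) :
    fderiv ℝ (fderiv ℝ φ) y u v = fderiv ℝ (fderiv ℝ φ) y v u :=
  (hφ.isSymmSndFDerivAt (by simp)) u v

/-- Differentiating the pulled-back metric in the Koszul formula produces six terms with second
derivatives of `φ`. By symmetry four cancel and the other two give twice `g (D²φ(u,v), Dφ w)`. Since
`Dφ` is onto and `g` is nondegenerate, pairing with every `Dφ w` determines the vector. -/
theorem leviCivita_transform {g g' : E → E →L[ℝ] E →L[ℝ] ℝ} {φ : E → E} {y : E}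
    {Γ Γ' : E →L[ℝ] E →L[ℝ] E}
    (hφ : ContDiffAt ℝ 2 φ y) (hg : DifferentiableAt ℝ g (φ y)) (hg' : DifferentiableAt ℝ g' y)
    (heq : ∀ᶠ z in 𝓝 y, ∀ u v, g' z u v = g (φ z) (fderiv ℝ φ z u) (fderiv ℝ φ z v))
    (symm : ∀ u v, g (φ y) u v = g (φ y) v u)
    (nondeg : ∀ u, (∀ v, g (φ y) u v = 0) → u = 0)
    (surj : Function.Surjective (fderiv ℝ φ y))
    (hΓ : IsLeviCivitaAt g Γ (φ y)) (hΓ' : IsLeviCivitaAt g' Γ' y) (u v : E) :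
    fderiv ℝ φ y (Γ' u v) =
      Γ (fderiv ℝ φ y u) (fderiv ℝ φ y v) + fderiv ℝ (fderiv ℝ φ) y u v := by
  have hd : ∀ w u v, fderiv ℝ g' y w u v =
      fderiv ℝ g (φ y) (fderiv ℝ φ y w) (fderiv ℝ φ y u) (fderiv ℝ φ y v)
      + g (φ y) (fderiv ℝ (fderiv ℝ φ) y w u) (fderiv ℝ φ y v)
      + g (φ y) (fderiv ℝ φ y u) (fderiv ℝ (fderiv ℝ φ) y w v) := by
    intro w u v
    rw [← fderiv_clm_apply₂ hg', ← fderiv_pullback hφ hg]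
    exact congrArg (fun L : E →L[ℝ] ℝ => L w)
      (EventuallyEq.fderiv_eq (heq.mono fun z hz => hz u v))
  rw [← sub_eq_zero]
  refine nondeg _ fun x => ?_
  obtain ⟨w, rfl⟩ := surj x
  have h1 := hΓ' u v w
  rw [heq.self_of_nhds, hd, hd, hd] at h1
  have h2 := hΓ (fderiv ℝ φ y u) (fderiv ℝ φ y v) (fderiv ℝ φ y w)
  have e1 := fderiv_fderiv_symm hφ u v
  have e2 := fderiv_fderiv_symm hφ u w
  have e3 := fderiv_fderiv_symm hφ v w
  rw [← e1, ← e2, ← e3, symm (fderiv ℝ φ y u) (fderiv ℝ (fderiv ℝ φ) y v w),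
    symm (fderiv ℝ φ y v) (fderiv ℝ (fderiv ℝ φ) y u w)] at h1
  simp only [map_sub, map_add, sub_apply, add_apply]
  linarith

/-- The curvature of the connection form `Γ`, as a function of its first vector. -/
def curvature (Γ : E → E →L[ℝ] E →L[ℝ] E) (y u v : E) : E →L[ℝ] E :=
  ((fderiv ℝ Γ y).flip u).flip v - (fderiv ℝ Γ y u).flip v + (Γ y).flip (Γ y u v)
    - (Γ y u).comp ((Γ y).flip v)

theorem curvature_apply (Γ : E → E →L[ℝ] E →L[ℝ] E) (y u v w : E) :
    curvature Γ y u v w =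
      fderiv ℝ Γ y w u v - fderiv ℝ Γ y u w v + Γ y w (Γ y u v) - Γ y u (Γ y w v) := by
  simp [curvature]

/-- Differentiate the inhomogeneous law for `Γ` and antisymmetrize in `u` and `w`. The third
derivatives of `φ` cancel, and the second derivatives are absorbed by applying the law again to the
quadratic terms. -/
theorem curvature_transform {Γ Γ' : E → E →L[ℝ] E →L[ℝ] E} {φ : E → E} {y : E}
    (hφ : ContDiffAt ℝ 3 φ y) (hΓ : DifferentiableAt ℝ Γ (φ y)) (hΓ' : DifferentiableAt ℝ Γ' y)
    (h : ∀ᶠ z in 𝓝 y, ∀ u v, fderiv ℝ φ z (Γ' z u v) =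
      Γ (φ z) (fderiv ℝ φ z u) (fderiv ℝ φ z v) + fderiv ℝ (fderiv ℝ φ) z u v) (u v w : E) :
    fderiv ℝ φ y (curvature Γ' y u v w) =
      curvature Γ (φ y) (fderiv ℝ φ y u) (fderiv ℝ φ y v) (fderiv ℝ φ y w) := by
  have hφ2 : ContDiffAt ℝ 2 φ y := hφ.of_le (by norm_num)
  have hφ' : ContDiffAt ℝ 2 (fderiv ℝ φ) y := hφ.fderiv_right (by norm_num)
  have h2 : DifferentiableAt ℝ (fderiv ℝ φ) y := hφ'.differentiableAt (by simp)
  have h3 : DifferentiableAt ℝ (fderiv ℝ (fderiv ℝ φ)) y :=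
    (hφ'.fderiv_right (m := 1) (by norm_num)).differentiableAt (by simp)
  have h1 : DifferentiableAt ℝ φ y := hφ.differentiableAt (by simp)
  have key : ∀ w u v, fderiv ℝ (fderiv ℝ φ) y w (Γ' y u v) + fderiv ℝ φ y (fderiv ℝ Γ' y w u v) =
      fderiv ℝ Γ (φ y) (fderiv ℝ φ y w) (fderiv ℝ φ y u) (fderiv ℝ φ y v)
      + Γ (φ y) (fderiv ℝ (fderiv ℝ φ) y w u) (fderiv ℝ φ y v)
      + Γ (φ y) (fderiv ℝ φ y u) (fderiv ℝ (fderiv ℝ φ) y w v)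
      + fderiv ℝ (fderiv ℝ (fderiv ℝ φ)) y w u v := by
    intro w u v
    have hl : DifferentiableAt ℝ (fun z => Γ' z u v) y :=
      (hΓ'.clm_apply (differentiableAt_const u)).clm_apply (differentiableAt_const v)
    have hc : DifferentiableAt ℝ (fun z => Γ (φ z)) y :=
      DifferentiableAt.comp (G := E →L[ℝ] E →L[ℝ] E) y hΓ h1
    have hr : DifferentiableAt ℝ (fun z => Γ (φ z) (fderiv ℝ φ z u) (fderiv ℝ φ z v)) y :=
      (hc.clm_apply (h2.clm_apply (differentiableAt_const u))).clm_apply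
        (h2.clm_apply (differentiableAt_const v))
    have hr' : DifferentiableAt ℝ (fun z => fderiv ℝ (fderiv ℝ φ) z u v) y :=
      (h3.clm_apply (differentiableAt_const u)).clm_apply (differentiableAt_const v)
    have e := congrArg (fun L : E →L[ℝ] E => L w)
      (EventuallyEq.fderiv_eq (h.mono fun z hz => hz u v))
    simp only [fderiv_fun_add hr hr', add_apply, fderiv_pullback hφ2 hΓ,
      fderiv_clm_apply₂ h3, fderiv_clm_apply h2 hl, ContinuousLinearMap.comp_apply,
      ContinuousLinearMap.flip_apply, fderiv_clm_apply₂ hΓ'] at e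
    rw [← e, add_comm]
  have h0 := h.self_of_nhds
  have k1 := key w u v
  have k2 := key u w v
  have s1 := fderiv_fderiv_symm hφ2 u w
  have s2 := fderiv_fderiv_symm hφ' u w
  rw [s1, s2] at k2
  rw [← eq_sub_iff_add_eq'] at k1 k2
  rw [curvature_apply, curvature_apply]
  simp only [map_add, map_sub, h0, k1, k2]
  abel

end Curvature

/-! ### Coordinate formulas as invariant traces, and invariance of the scalar curvature -/

section CoordinateInvariance

variable {n : ℕ}

/-- The bilinear form with matrix `A`. -/
def matrixForm (A : Matrix (Fin n) (Fin n) ℝ) :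
    EuclideanSpace ℝ (Fin n) →L[ℝ] EuclideanSpace ℝ (Fin n) →L[ℝ] ℝ :=
  ∑ i, ∑ j, A i j • (EuclideanSpace.proj i : EuclideanSpace ℝ (Fin n) →L[ℝ] ℝ).smulRight
    (EuclideanSpace.proj j : EuclideanSpace ℝ (Fin n) →L[ℝ] ℝ)

theorem matrixForm_apply (A : Matrix (Fin n) (Fin n) ℝ) (u v : EuclideanSpace ℝ (Fin n)) :
    matrixForm A u v = ∑ i, ∑ j, A i j * (u i * v j) := by
  simp [matrixForm]

@[simp] theorem matrixForm_single (A : Matrix (Fin n) (Fin n) ℝ) (i j : Fin n) :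
    matrixForm A (EuclideanSpace.single i 1) (EuclideanSpace.single j 1) = A i j := by
  simp [matrixForm_apply]

/-- The Christoffel symbols of `G`, as a bilinear map. -/
def christoffelForm (G : EuclideanSpace ℝ (Fin n) → Matrix (Fin n) (Fin n) ℝ)
    (y : EuclideanSpace ℝ (Fin n)) :
    EuclideanSpace ℝ (Fin n) →L[ℝ] EuclideanSpace ℝ (Fin n) →L[ℝ] EuclideanSpace ℝ (Fin n) :=
  ∑ l, ∑ i, ∑ j, christoffel G l i j y •
    (EuclideanSpace.proj i : EuclideanSpace ℝ (Fin n) →L[ℝ] ℝ).smulRight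
      ((EuclideanSpace.proj j : EuclideanSpace ℝ (Fin n) →L[ℝ] ℝ).smulRight
        (EuclideanSpace.single l (1 : ℝ)))

theorem christoffelForm_apply (G : EuclideanSpace ℝ (Fin n) → Matrix (Fin n) (Fin n) ℝ)
    (y u v : EuclideanSpace ℝ (Fin n)) (l : Fin n) :
    christoffelForm G y u v l = ∑ i, ∑ j, christoffel G l i j y * (u i * v j) := by
  simp only [christoffelForm, sum_apply, smul_apply, ContinuousLinearMap.smulRight_apply,
    PiLp.proj_apply, WithLp.ofLp_sum, Finset.sum_apply, PiLp.smul_apply, smul_eq_mul]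
  rw [Finset.sum_eq_single l (fun b _ hb => by simp [hb.symm]) (by simp)]
  simp

@[simp] theorem christoffelForm_single (G : EuclideanSpace ℝ (Fin n) → Matrix (Fin n) (Fin n) ℝ)
    (y : EuclideanSpace ℝ (Fin n)) (i j l : Fin n) :
    christoffelForm G y (EuclideanSpace.single i 1) (EuclideanSpace.single j 1) l =
      christoffel G l i j y := by
  simp [christoffelForm_apply]

/-- `G` is a smooth field of positive definite matrices on `U`. -/
structure IsMetricOn (G : EuclideanSpace ℝ (Fin n) → Matrix (Fin n) (Fin n) ℝ)
    (U : Set (EuclideanSpace ℝ (Fin n))) : Prop where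
  isOpen : IsOpen U
  contDiffOn : ∀ i j, ContDiffOn ℝ ∞ (fun y => G y i j) U
  posDef : ∀ y ∈ U, (G y).PosDef

theorem contDiffOn_smul_const {E F : Type*} [NormedAddCommGroup E] [NormedSpace ℝ E]
    [NormedAddCommGroup F] [NormedSpace ℝ F] {f : E → ℝ} {U : Set E} (hf : ContDiffOn ℝ ∞ f U)
    (c : F) : ContDiffOn ℝ ∞ (fun y => f y • c) U :=
  hf.smul contDiffOn_const

theorem contDiffOn_det {ι : Type*} [Fintype ι] [DecidableEq ι] {E : Type*} [NormedAddCommGroup E]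
    [NormedSpace ℝ E] {U : Set E}
    {A : E → Matrix ι ι ℝ} (hA : ∀ i j, ContDiffOn ℝ ∞ (fun y => A y i j) U) :
    ContDiffOn ℝ ∞ (fun y => (A y).det) U := by
  simp only [Matrix.det_apply']
  exact ContDiffOn.sum fun σ _ => contDiffOn_const.mul (contDiffOn_prod fun i _ => hA _ _)

theorem contDiffOn_inv {ι : Type*} [Fintype ι] [DecidableEq ι] {E : Type*} [NormedAddCommGroup E]
    [NormedSpace ℝ E] {U : Set E}
    {A : E → Matrix ι ι ℝ} (hA : ∀ i j, ContDiffOn ℝ ∞ (fun y => A y i j) U)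
    (h0 : ∀ y ∈ U, (A y).det ≠ 0) (i j : ι) :
    ContDiffOn ℝ ∞ (fun y => (A y)⁻¹ i j) U := by
  simp only [Matrix.inv_def, Matrix.smul_apply, Matrix.adjugate_apply, Ring.inverse_eq_inv',
    smul_eq_mul]
  refine ((contDiffOn_det hA).inv h0).mul (contDiffOn_det fun k l => ?_)
  by_cases h : k = j
  · subst h; simpa using contDiffOn_const
  · simpa [Matrix.updateRow_ne h] using hA k l

variable {G : EuclideanSpace ℝ (Fin n) → Matrix (Fin n) (Fin n) ℝ}
  {U : Set (EuclideanSpace ℝ (Fin n))} {y : EuclideanSpace ℝ (Fin n)}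

theorem contDiffOn_partialDeriv {f : EuclideanSpace ℝ (Fin n) → ℝ} (hU : IsOpen U)
    (hf : ContDiffOn ℝ ∞ f U) (k : Fin n) : ContDiffOn ℝ ∞ (partialDeriv k f) U :=
  (hf.fderiv_of_isOpen hU (by simp)).clm_apply contDiffOn_const

namespace IsMetricOn

theorem det_ne_zero (hG : IsMetricOn G U) (hy : y ∈ U) : (G y).det ≠ 0 :=
  (hG.posDef y hy).det_pos.ne'

theorem apply_symm (hG : IsMetricOn G U) (hy : y ∈ U) (i j : Fin n) : G y i j = G y j i := by
  simpa using ((hG.posDef y hy).isHermitian.apply i j).symm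

theorem contDiffOn_inv (hG : IsMetricOn G U) (i j : Fin n) :
    ContDiffOn ℝ ∞ (fun y => (G y)⁻¹ i j) U :=
  Yamabe.contDiffOn_inv hG.contDiffOn (fun _ h => hG.det_ne_zero h) i j

theorem contDiffOn_christoffel (hG : IsMetricOn G U) (l i j : Fin n) :
    ContDiffOn ℝ ∞ (christoffel G l i j) U :=
  contDiffOn_const.mul <| ContDiffOn.sum fun m _ => (hG.contDiffOn_inv l m).mul <|
    ((contDiffOn_partialDeriv hG.isOpen (hG.contDiffOn j m) i).add
      (contDiffOn_partialDeriv hG.isOpen (hG.contDiffOn i m) j)).sub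
      (contDiffOn_partialDeriv hG.isOpen (hG.contDiffOn i j) m)

theorem contDiffOn_coordRicci (hG : IsMetricOn G U) (j k : Fin n) :
    ContDiffOn ℝ ∞ (coordRicci G j k) U := by
  refine (ContDiffOn.sum fun i _ => ?_).add (ContDiffOn.sum fun i _ => ContDiffOn.sum fun m _ => ?_)
  · exact (contDiffOn_partialDeriv hG.isOpen (hG.contDiffOn_christoffel _ _ _) _).sub
      (contDiffOn_partialDeriv hG.isOpen (hG.contDiffOn_christoffel _ _ _) _)
  · exact ((hG.contDiffOn_christoffel _ _ _).mul (hG.contDiffOn_christoffel _ _ _)).sub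
      ((hG.contDiffOn_christoffel _ _ _).mul (hG.contDiffOn_christoffel _ _ _))

theorem contDiffOn_coordScal (hG : IsMetricOn G U) : ContDiffOn ℝ ∞ (coordScal G) U :=
  ContDiffOn.sum fun _ _ => ContDiffOn.sum fun _ _ =>
    (hG.contDiffOn_inv _ _).mul (hG.contDiffOn_coordRicci _ _)

theorem contDiffOn_matrixForm (hG : IsMetricOn G U) :
    ContDiffOn ℝ ∞ (fun y => matrixForm (G y)) U :=
  ContDiffOn.sum fun _ _ => ContDiffOn.sum fun _ _ => contDiffOn_smul_const (hG.contDiffOn _ _) _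

theorem contDiffOn_christoffelForm (hG : IsMetricOn G U) :
    ContDiffOn ℝ ∞ (christoffelForm G) U :=
  ContDiffOn.sum fun _ _ => ContDiffOn.sum fun _ _ => ContDiffOn.sum fun _ _ =>
    contDiffOn_smul_const (hG.contDiffOn_christoffel _ _ _) _

theorem differentiableAt_matrixForm (hG : IsMetricOn G U) (hy : y ∈ U) :
    DifferentiableAt ℝ (fun y => matrixForm (G y)) y :=
  (hG.contDiffOn_matrixForm.contDiffAt (hG.isOpen.mem_nhds hy)).differentiableAt (by simp)

theorem differentiableAt_christoffelForm (hG : IsMetricOn G U) (hy : y ∈ U) :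
    DifferentiableAt ℝ (christoffelForm G) y :=
  (hG.contDiffOn_christoffelForm.contDiffAt (hG.isOpen.mem_nhds hy)).differentiableAt (by simp)

end IsMetricOn

set_option synthInstance.maxHeartbeats 200000 in
theorem trilinear_apply (A : EuclideanSpace ℝ (Fin n) →L[ℝ] EuclideanSpace ℝ (Fin n) →L[ℝ]
      EuclideanSpace ℝ (Fin n) →L[ℝ] ℝ) (u v w : EuclideanSpace ℝ (Fin n)) :
    A u v w = ∑ i, ∑ j, ∑ k, u i * v j * w k * A (EuclideanSpace.single i 1)
      (EuclideanSpace.single j 1) (EuclideanSpace.single k 1) := by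
  have h : ∀ x : EuclideanSpace ℝ (Fin n), x = ∑ i, x i • EuclideanSpace.single i (1 : ℝ) := by
    intro x; ext i; simp [Pi.single_apply]
  conv_lhs => rw [h u, h v, h w]
  simp only [map_sum, map_smul, sum_apply, smul_apply, smul_eq_mul, Finset.mul_sum]
  rw [← Finset.sum_comm_cycle, Finset.sum_comm]
  refine Finset.sum_congr rfl fun i _ => Finset.sum_congr rfl fun j _ =>
    Finset.sum_congr rfl fun k _ => ?_
  ring

theorem isLeviCivitaAt_christoffelForm (hG : IsMetricOn G U) (hy : y ∈ U) :
    IsLeviCivitaAt (fun z => matrixForm (G z)) (christoffelForm G y) y := by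
  intro u v w
  have hd := hG.differentiableAt_matrixForm hy
  have hp : ∀ i j k, fderiv ℝ (fun z => matrixForm (G z)) y (EuclideanSpace.single i 1)
      (EuclideanSpace.single j 1) (EuclideanSpace.single k 1) =
        partialDeriv i (fun z => G z j k) y := by
    intro i j k
    rw [← fderiv_clm_apply₂ hd]
    simp [partialDeriv]
  have hL : matrixForm (G y) (christoffelForm G y u v) w =
      ∑ i, ∑ j, ∑ k, u i * v j * w k * ∑ l, G y l k * christoffel G l i j y := by
    simp only [matrixForm_apply, christoffelForm_apply, Finset.mul_sum, Finset.sum_mul]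
    rw [Finset.sum_congr rfl fun l _ => Finset.sum_comm_cycle.symm, ← Finset.sum_comm_cycle]
    refine Finset.sum_congr rfl fun i _ => Finset.sum_congr rfl fun j _ => ?_
    rw [Finset.sum_comm]
    refine Finset.sum_congr rfl fun k _ => Finset.sum_congr rfl fun l _ => ?_
    ring
  -- Lowering the upper index of `Γ` cancels the inverse matrix in its definition.
  have hl : ∀ i j k, 2 * ∑ l, G y l k * christoffel G l i j y =
      partialDeriv i (fun z => G z j k) y + partialDeriv j (fun z => G z i k) y
      - partialDeriv k (fun z => G z i j) y := by
    intro i j k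
    have hinv : ∀ m, ∑ l, G y l k * (G y)⁻¹ l m = if k = m then 1 else 0 := by
      intro m
      rw [← Matrix.one_apply, ← Matrix.mul_nonsing_inv (G y) (hG.det_ne_zero hy).isUnit,
        Matrix.mul_apply]
      exact Finset.sum_congr rfl fun l _ => by rw [hG.apply_symm hy l k]
    simp only [christoffel, Finset.mul_sum]
    rw [Finset.sum_comm]
    have : ∀ m, ∑ l, 2 * (G y l k * (1 / 2 * ((G y)⁻¹ l m *
        (partialDeriv i (fun z => G z j m) y + partialDeriv j (fun z => G z i m) y
          - partialDeriv m (fun z => G z i j) y)))) = (if k = m then 1 else 0) *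
        (partialDeriv i (fun z => G z j m) y + partialDeriv j (fun z => G z i m) y
          - partialDeriv m (fun z => G z i j) y) := by
      intro m
      rw [← hinv, Finset.sum_mul]
      exact Finset.sum_congr rfl fun l _ => by ring
    simp only [this]
    simp
  rw [trilinear_apply _ u v w, trilinear_apply _ v u w, trilinear_apply _ w u v, hL]
  simp only [hp]
  -- Relabelling indices gives the three Koszul terms the common coefficient `u i * v j * w k`, so
  -- that `hl` applies termwise.
  have e1 : ∑ i, ∑ j, ∑ k, v i * u j * w k * partialDeriv i (fun z => G z j k) y =
      ∑ i, ∑ j, ∑ k, u i * v j * w k * partialDeriv j (fun z => G z i k) y := by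
    rw [Finset.sum_comm]
    simp only [mul_comm (v _) (u _)]
  have e2 : ∑ i, ∑ j, ∑ k, w i * u j * v k * partialDeriv i (fun z => G z j k) y =
      ∑ i, ∑ j, ∑ k, u i * v j * w k * partialDeriv k (fun z => G z i j) y := by
    rw [Finset.sum_comm]
    refine Finset.sum_congr rfl fun i _ => ?_
    rw [Finset.sum_comm]
    refine Finset.sum_congr rfl fun j _ => Finset.sum_congr rfl fun k _ => ?_
    ring
  rw [e1, e2, Finset.mul_sum]
  simp only [← Finset.sum_add_distrib, ← Finset.sum_sub_distrib, Finset.mul_sum]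
  refine Finset.sum_congr rfl fun i _ => Finset.sum_congr rfl fun j _ =>
    Finset.sum_congr rfl fun k _ => ?_
  rw [← Finset.mul_sum, ← Finset.mul_sum]
  linear_combination (u i * v j * w k) * hl i j k

theorem trace_eq_sum (T : EuclideanSpace ℝ (Fin n) →L[ℝ] EuclideanSpace ℝ (Fin n)) :
    LinearMap.trace ℝ _ (T : EuclideanSpace ℝ (Fin n) →ₗ[ℝ] EuclideanSpace ℝ (Fin n)) =
      ∑ i, T (EuclideanSpace.single i 1) i := by
  rw [LinearMap.trace_eq_matrix_trace ℝ (EuclideanSpace.basisFun (Fin n) ℝ).toBasis]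
  simp [Matrix.trace, LinearMap.toMatrix_apply]

/-- This turns the index formula into a trace over the first vector of the curvature, an object
whose behaviour under linear changes is clear. -/
theorem coordRicci_eq_trace (hG : IsMetricOn G U) (hy : y ∈ U) (j k : Fin n) :
    coordRicci G j k y = LinearMap.trace ℝ _ (curvature (christoffelForm G) y
      (EuclideanSpace.single j 1) (EuclideanSpace.single k 1) :
        EuclideanSpace ℝ (Fin n) →ₗ[ℝ] EuclideanSpace ℝ (Fin n)) := by
  have hd := hG.differentiableAt_christoffelForm hy
  have hp : ∀ i j k l, fderiv ℝ (christoffelForm G) y (EuclideanSpace.single i 1)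
      (EuclideanSpace.single j 1) (EuclideanSpace.single k 1) l =
        partialDeriv i (christoffel G l j k) y := by
    intro i j k l
    have h1 : DifferentiableAt ℝ (fun z => christoffelForm G z (EuclideanSpace.single j 1)
      (EuclideanSpace.single k 1)) y :=
        (hd.clm_apply (differentiableAt_const _)).clm_apply (differentiableAt_const _)
    have h2 := ((EuclideanSpace.proj l : EuclideanSpace ℝ (Fin n) →L[ℝ] ℝ).hasFDerivAt.comp y
      h1.hasFDerivAt).fderiv
    rw [← fderiv_clm_apply₂ hd]
    have h3 : (⇑(EuclideanSpace.proj l : EuclideanSpace ℝ (Fin n) →L[ℝ] ℝ) ∘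
      fun z => christoffelForm G z (EuclideanSpace.single j 1) (EuclideanSpace.single k 1)) =
        christoffel G l j k := by
      ext z; simp
    rw [h3] at h2
    simp [partialDeriv, h2]
  rw [trace_eq_sum, coordRicci]
  rw [← Finset.sum_add_distrib]
  refine Finset.sum_congr rfl fun i _ => ?_
  rw [curvature_apply]
  simp only [PiLp.sub_apply, PiLp.add_apply, hp]
  have hc : ∀ a b c, christoffelForm G y (EuclideanSpace.single a 1) (christoffelForm G y
      (EuclideanSpace.single b 1) (EuclideanSpace.single c 1)) i =
        ∑ m, christoffel G i a m y * christoffel G m b c y := by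
    intro a b c
    rw [christoffelForm_apply, Finset.sum_eq_single a (fun x _ hx => by simp [hx]) (by simp)]
    simp
  rw [hc, hc, Finset.sum_sub_distrib]
  ring

section

variable {E : Type*} [NormedAddCommGroup E] [NormedSpace ℝ E]
  (Γ : E → E →L[ℝ] E →L[ℝ] E) (y : E)

set_option synthInstance.maxHeartbeats 200000 in
theorem curvature_add_left (u u' v : E) :
    curvature Γ y (u + u') v = curvature Γ y u v + curvature Γ y u' v := by
  ext w
  simp only [curvature_apply, map_add, add_apply]
  abel

set_option synthInstance.maxHeartbeats 200000 in
theorem curvature_smul_left (c : ℝ) (u v : E) :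
    curvature Γ y (c • u) v = c • curvature Γ y u v := by
  ext w
  simp only [curvature_apply, map_smul, smul_apply, smul_sub, smul_add]

theorem curvature_add_right (u v v' : E) :
    curvature Γ y u (v + v') = curvature Γ y u v + curvature Γ y u v' := by
  ext w
  simp only [curvature_apply, map_add, add_apply]
  abel

theorem curvature_smul_right (c : ℝ) (u v : E) :
    curvature Γ y u (c • v) = c • curvature Γ y u v := by
  ext w
  simp only [curvature_apply, map_smul, smul_apply, smul_sub, smul_add]

/-- The Ricci form of a connection form. -/
def ricciForm : E →ₗ[ℝ] E →ₗ[ℝ] ℝ :=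
  LinearMap.mk₂ ℝ (fun u v => LinearMap.trace ℝ E (curvature Γ y u v : E →ₗ[ℝ] E))
    (fun u u' v => by rw [curvature_add_left, ContinuousLinearMap.toLinearMap_add, map_add])
    (fun c u v => by rw [curvature_smul_left, ContinuousLinearMap.toLinearMap_smul, map_smul])
    (fun u v v' => by rw [curvature_add_right, ContinuousLinearMap.toLinearMap_add, map_add])
    (fun c u v => by rw [curvature_smul_right, ContinuousLinearMap.toLinearMap_smul, map_smul])

end

/-- The two curvature endomorphisms are conjugate by `L`, and conjugation preserves the trace. -/
theorem ricciForm_transform {E : Type*} [NormedAddCommGroup E] [NormedSpace ℝ E]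
    {Γ Γ' : E → E →L[ℝ] E →L[ℝ] E} {y y' : E} {L : E →L[ℝ] E}
    (hL : Function.Bijective L)
    (h : ∀ u v w, L (curvature Γ' y' u v w) = curvature Γ y (L u) (L v) (L w)) (u v : E) :
    ricciForm Γ' y' u v = ricciForm Γ y (L u) (L v) := by
  let e : E ≃ₗ[ℝ] E := LinearEquiv.ofBijective (L : E →ₗ[ℝ] E) hL
  simp only [ricciForm, LinearMap.mk₂_apply]
  rw [← LinearMap.trace_conj' (curvature Γ' y' u v : E →ₗ[ℝ] E) e]
  congr 1
  ext x
  obtain ⟨w, rfl⟩ := e.surjective x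
  simp only [LinearEquiv.conj_apply, LinearMap.comp_apply, LinearEquiv.coe_coe,
    LinearEquiv.symm_apply_apply]
  exact h u v w

theorem coordScal_eq_trace (G : EuclideanSpace ℝ (Fin n) → Matrix (Fin n) (Fin n) ℝ)
    (y : EuclideanSpace ℝ (Fin n)) :
    coordScal G y = ((G y)⁻¹ * (Matrix.of fun j k => coordRicci G j k y)ᵀ).trace := by
  simp [coordScal, Matrix.trace, Matrix.mul_apply]

/-- Stated for arbitrary bilinear forms because it serves both the metric and the Ricci form. -/
theorem matrix_eq_congr {A A' J : Matrix (Fin n) (Fin n) ℝ}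
    {B B' : EuclideanSpace ℝ (Fin n) →ₗ[ℝ] EuclideanSpace ℝ (Fin n) →ₗ[ℝ] ℝ}
    {L : EuclideanSpace ℝ (Fin n) →L[ℝ] EuclideanSpace ℝ (Fin n)}
    (hA : ∀ i j, A i j = B (EuclideanSpace.single i 1) (EuclideanSpace.single j 1))
    (hA' : ∀ i j, A' i j = B' (EuclideanSpace.single i 1) (EuclideanSpace.single j 1))
    (hJ : ∀ i j, J i j = L (EuclideanSpace.single j 1) i)
    (h : ∀ u v, B' u v = B (L u) (L v)) : A' = Jᵀ * A * J := by
  have hx : ∀ x : EuclideanSpace ℝ (Fin n), x = ∑ i, x i • EuclideanSpace.single i (1 : ℝ) := by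
    intro x; ext i; simp [Pi.single_apply]
  ext i j
  rw [hA', h, hx (L (EuclideanSpace.single i 1)), hx (L (EuclideanSpace.single j 1))]
  simp only [map_sum, map_smul, LinearMap.sum_apply, LinearMap.smul_apply, smul_eq_mul, ← hA,
    ← hJ, Matrix.mul_apply, Matrix.transpose_apply, Finset.sum_mul, Finset.mul_sum]
  refine Finset.sum_congr rfl fun a _ => Finset.sum_congr rfl fun b _ => ?_
  ring

/-- The matrix of `L` in the standard basis. -/
def stdMatrix (L : EuclideanSpace ℝ (Fin n) →L[ℝ] EuclideanSpace ℝ (Fin n)) :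
    Matrix (Fin n) (Fin n) ℝ :=
  Matrix.of fun i j => L (EuclideanSpace.single j 1) i

theorem matrix_eq_of_matrixForm {A A' : Matrix (Fin n) (Fin n) ℝ}
    {L : EuclideanSpace ℝ (Fin n) →L[ℝ] EuclideanSpace ℝ (Fin n)}
    (h : ∀ u v, matrixForm A' u v = matrixForm A (L u) (L v)) :
    A' = (stdMatrix L)ᵀ * A * stdMatrix L :=
  matrix_eq_congr (B := (ContinuousLinearMap.coeLM ℝ).comp (matrixForm A).toLinearMap)
    (B' := (ContinuousLinearMap.coeLM ℝ).comp (matrixForm A').toLinearMap) (L := L)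
    (fun i j => by simp) (fun i j => by simp) (fun i j => rfl) (by simpa using h)

/-- A kernel vector of `L` would be null for the positive definite form `A'`; finite dimension then
gives surjectivity. -/
theorem bijective_of_matrixForm {A A' : Matrix (Fin n) (Fin n) ℝ}
    {L : EuclideanSpace ℝ (Fin n) →L[ℝ] EuclideanSpace ℝ (Fin n)}
    (h : ∀ u v, matrixForm A' u v = matrixForm A (L u) (L v)) (hA' : A'.PosDef) :
    Function.Bijective L := by
  have hinj : Function.Injective (L : EuclideanSpace ℝ (Fin n) →ₗ[ℝ] EuclideanSpace ℝ (Fin n)) := by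
    rw [injective_iff_map_eq_zero]
    intro u hu
    by_contra hne
    have h0 : matrixForm A' u u = 0 := by
      rw [h]; simp [show L u = 0 from hu]
    have := hA'.dotProduct_mulVec_pos (x := u.ofLp) (by simpa using hne)
    rw [matrixForm_apply] at h0
    simp only [dotProduct, Matrix.mulVec, Finset.mul_sum] at this
    refine this.ne' (h0 ▸ ?_)
    refine Finset.sum_congr rfl fun i _ => Finset.sum_congr rfl fun j _ => ?_
    simp; ring
  exact ⟨hinj, LinearMap.injective_iff_surjective.1 hinj⟩

theorem matrixForm_nondegenerate {A : Matrix (Fin n) (Fin n) ℝ} (hA : A.PosDef)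
    {u : EuclideanSpace ℝ (Fin n)} (h : ∀ v, matrixForm A u v = 0) : u = 0 := by
  by_contra hne
  have := hA.dotProduct_mulVec_pos (x := u.ofLp) (by simpa using hne)
  simp only [dotProduct, Matrix.mulVec, Finset.mul_sum] at this
  have h0 := h u
  rw [matrixForm_apply] at h0
  refine this.ne' (h0 ▸ ?_)
  refine Finset.sum_congr rfl fun i _ => Finset.sum_congr rfl fun j _ => ?_
  simp; ring

theorem matrixForm_symm {A : Matrix (Fin n) (Fin n) ℝ} (hA : ∀ i j, A i j = A j i)
    (u v : EuclideanSpace ℝ (Fin n)) : matrixForm A u v = matrixForm A v u := by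
  rw [matrixForm_apply, matrixForm_apply, Finset.sum_comm]
  refine Finset.sum_congr rfl fun i _ => Finset.sum_congr rfl fun j _ => ?_
  rw [hA]; ring

/-- The scalar curvature does not depend on the coordinates. -/
theorem coordScal_transform {G G' : EuclideanSpace ℝ (Fin n) → Matrix (Fin n) (Fin n) ℝ}
    {U U' : Set (EuclideanSpace ℝ (Fin n))}
    {φ : EuclideanSpace ℝ (Fin n) → EuclideanSpace ℝ (Fin n)} {y : EuclideanSpace ℝ (Fin n)}
    (hG : IsMetricOn G U) (hG' : IsMetricOn G' U') (hy : y ∈ U') (hy' : φ y ∈ U)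
    (hφ : ContDiffAt ℝ 3 φ y)
    (h : ∀ᶠ z in 𝓝 y, ∀ u v,
      matrixForm (G' z) u v = matrixForm (G (φ z)) (fderiv ℝ φ z u) (fderiv ℝ φ z v)) :
    coordScal G' y = coordScal G (φ y) := by
  -- The law is needed on a neighbourhood, since the curvature differentiates it once more.
  have hΓ : ∀ᶠ z in 𝓝 y, ∀ u v, fderiv ℝ φ z (christoffelForm G' z u v) =
      christoffelForm G (φ z) (fderiv ℝ φ z u) (fderiv ℝ φ z v) +
        fderiv ℝ (fderiv ℝ φ) z u v := by
    filter_upwards [hG'.isOpen.mem_nhds hy,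
      hφ.continuousAt.preimage_mem_nhds (hG.isOpen.mem_nhds hy'), hφ.eventually (by simp),
      eventually_eventually_nhds.2 h] with z hz hz' hφz hev
    exact leviCivita_transform (g := fun z => matrixForm (G z)) (g' := fun z => matrixForm (G' z))
      (hφz.of_le (by norm_num)) (hG.differentiableAt_matrixForm hz')
      (hG'.differentiableAt_matrixForm hz) hev
      (matrixForm_symm fun i j => hG.apply_symm hz' i j)
      (fun u hu => matrixForm_nondegenerate (hG.posDef _ hz') hu)
      (bijective_of_matrixForm hev.self_of_nhds (hG'.posDef z hz)).2
      (isLeviCivitaAt_christoffelForm hG hz') (isLeviCivitaAt_christoffelForm hG' hz)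
  have hbij := bijective_of_matrixForm h.self_of_nhds (hG'.posDef y hy)
  have hR := ricciForm_transform hbij (curvature_transform hφ
    (hG.differentiableAt_christoffelForm hy') (hG'.differentiableAt_christoffelForm hy) hΓ)
  have e1 := matrix_eq_of_matrixForm h.self_of_nhds
  have e2 := matrix_eq_congr (A := Matrix.of fun j k => coordRicci G j k (φ y))
    (A' := Matrix.of fun j k => coordRicci G' j k y) (J := stdMatrix (fderiv ℝ φ y))
    (fun i j => by simpa [ricciForm] using coordRicci_eq_trace hG hy' i j)
    (fun i j => by simpa [ricciForm] using coordRicci_eq_trace hG' hy i j) (fun i j => rfl) hR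
  have hdet := hG'.det_ne_zero hy
  -- With `G' = JᵀGJ` and `Ric' = JᵀRicJ`, the product `G'⁻¹ Ric'ᵀ` is conjugate by `J` to `G⁻¹
  -- Ricᵀ`, so the traces agree.
  rw [coordScal_eq_trace, coordScal_eq_trace, e2]
  generalize stdMatrix (fderiv ℝ φ y) = J at e1
  rw [e1] at hdet ⊢
  have hJ : IsUnit J.det := by
    rw [Matrix.det_mul] at hdet
    exact (right_ne_zero_of_mul hdet).isUnit
  have hJt : IsUnit Jᵀ.det := by rwa [Matrix.det_transpose]
  rw [Matrix.mul_inv_rev, Matrix.mul_inv_rev, Matrix.transpose_mul, Matrix.transpose_mul,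
    Matrix.transpose_transpose]
  generalize (G (φ y))⁻¹ = A
  generalize (Matrix.of fun j k => coordRicci G j k (φ y))ᵀ = B
  rw [show J⁻¹ * (A * Jᵀ⁻¹) * (Jᵀ * (B * J)) = J⁻¹ * (A * (Jᵀ⁻¹ * Jᵀ) * B * J) by
    simp only [Matrix.mul_assoc], Matrix.nonsing_inv_mul _ hJt, Matrix.mul_one, Matrix.trace_mul_comm,
    Matrix.mul_assoc, Matrix.mul_nonsing_inv _ hJ, Matrix.mul_one]

end CoordinateInvariance

/-! ### Metric components in charts and continuity of the scalar curvature -/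

section Charts

variable {n : ℕ} {M : Type*} [TopologicalSpace M]
  [ChartedSpace (EuclideanSpace ℝ (Fin n)) M] [IsManifold (𝓡 n) ∞ M]
  {e e' : OpenPartialHomeomorph M (EuclideanSpace ℝ (Fin n))}

/-- The metric at the point with coordinates `y`, pulled back to the coordinate space. -/
theorem matrixForm_chartGram (g : Metric n M)
    (e : OpenPartialHomeomorph M (EuclideanSpace ℝ (Fin n)))
    (y u v : EuclideanSpace ℝ (Fin n)) :
    matrixForm (chartGram g e y) u v = g.inner (e.symm y)
      (mfderiv (𝓡 n) (𝓡 n) e.symm y u) (mfderiv (𝓡 n) (𝓡 n) e.symm y v) := by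
  have h : ∀ x : EuclideanSpace ℝ (Fin n), x = ∑ i, x i • EuclideanSpace.single i (1 : ℝ) := by
    intro x; ext i; simp [Pi.single_apply]
  let D : EuclideanSpace ℝ (Fin n) →L[ℝ] EuclideanSpace ℝ (Fin n) :=
    mfderiv (𝓡 n) (𝓡 n) e.symm y
  let B : EuclideanSpace ℝ (Fin n) →L[ℝ] EuclideanSpace ℝ (Fin n) →L[ℝ] ℝ := g.inner (e.symm y)
  have hB : ∀ i j, chartGram g e y i j =
      B (D (EuclideanSpace.single i 1)) (D (EuclideanSpace.single j 1)) := fun i j => rfl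
  change _ = B (D u) (D v)
  rw [matrixForm_apply]
  conv_rhs => rw [h u, h v]
  simp only [map_sum, map_smul, sum_apply, smul_apply, smul_eq_mul, Finset.mul_sum, hB]
  rw [Finset.sum_comm]
  refine Finset.sum_congr rfl fun i _ => Finset.sum_congr rfl fun j _ => ?_
  ring

/-- The coordinate fields are smooth maps into the tangent bundle, being constant fields pushed
forward by `e.symm`; the metric is a smooth section, and the pairing of smooth sections is smooth.
-/
theorem contDiffOn_chartGram (g : Metric n M) (he : e ∈ atlas (EuclideanSpace ℝ (Fin n)) M)
    (i j : Fin n) : ContDiffOn ℝ ∞ (fun y => chartGram g e y i j) e.target := by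
  have hs : ∀ i : Fin n, ContMDiffOn (𝓡 n) (𝓡 n).tangent ∞
      (fun y => (⟨e.symm y, mfderiv (𝓡 n) (𝓡 n) e.symm y (EuclideanSpace.single i (1 : ℝ))⟩ :
        TangentBundle (𝓡 n) M)) e.target := by
    intro i
    have h1 : ContMDiffOn (𝓡 n) (𝓡 n).tangent ∞ (fun y => (⟨y, EuclideanSpace.single i (1 : ℝ)⟩ :
        TangentBundle (𝓡 n) (EuclideanSpace ℝ (Fin n)))) e.target :=
      contMDiffOn_vectorSpace_iff_contDiffOn.2 contDiffOn_const
    have h2 := (contMDiffOn_symm_of_mem_maximalAtlas (n := ∞) (I := 𝓡 n)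
      (IsManifold.subset_maximalAtlas he)).contMDiffOn_tangentMapWithin (m := ∞) (by simp)
      e.open_target.uniqueMDiffOn
    refine (h2.comp h1 fun y hy => hy).congr fun y hy => ?_
    simp only [Function.comp_def, tangentMapWithin]
    rw [mfderivWithin_of_isOpen e.open_target hy]
  have hg : ContMDiffOn (𝓡 n) ((𝓡 n).prod 𝓘(ℝ, EuclideanSpace ℝ (Fin n) →L[ℝ]
      EuclideanSpace ℝ (Fin n) →L[ℝ] ℝ)) ∞ (fun y => TotalSpace.mk' (EuclideanSpace ℝ (Fin n) →L[ℝ]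
      EuclideanSpace ℝ (Fin n) →L[ℝ] ℝ) (E := fun x : M => TangentSpace (𝓡 n) x →L[ℝ]
        TangentSpace (𝓡 n) x →L[ℝ] ℝ) (e.symm y) (g.inner (e.symm y))) e.target :=
    g.contMDiff.comp_contMDiffOn (contMDiffOn_symm_of_mem_maximalAtlas (n := ∞) (I := 𝓡 n)
      (IsManifold.subset_maximalAtlas he))
  intro y hy
  have h := ContMDiffWithinAt.clm_bundle_apply₂ (F₃ := ℝ) (E₃ := Bundle.Trivial M ℝ)
    (hg y hy) (hs i y hy) (hs j y hy)
  rw [contMDiffWithinAt_totalSpace] at h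
  exact contMDiffWithinAt_iff_contDiffWithinAt.1 h.2

theorem mfderiv_symm_injective (he : e ∈ atlas (EuclideanSpace ℝ (Fin n)) M)
    {y : EuclideanSpace ℝ (Fin n)} (hy : y ∈ e.target) :
    Function.Injective (mfderiv (𝓡 n) (𝓡 n) e.symm y) :=
  (mdifferentiable_of_mem_atlas (I := 𝓡 n) he).symm.mfderiv_injective hy

theorem isMetricOn_chartGram (g : Metric n M) (he : e ∈ atlas (EuclideanSpace ℝ (Fin n)) M) :
    IsMetricOn (chartGram g e) e.target where
  isOpen := e.open_target
  contDiffOn := contDiffOn_chartGram g he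
  posDef y hy := by
    refine Matrix.PosDef.of_dotProduct_mulVec_pos ?_ fun {x} hx => ?_
    · ext i j
      simp [chartGram, g.symm (e.symm y) (mfderiv (𝓡 n) (𝓡 n) e.symm y (EuclideanSpace.single i 1))]
    · have h := matrixForm_chartGram g e y (WithLp.toLp 2 x) (WithLp.toLp 2 x)
      have hpos := g.pos (e.symm y) (mfderiv (𝓡 n) (𝓡 n) e.symm y (WithLp.toLp 2 x))
        (fun h0 => hx (by
          have := mfderiv_symm_injective he hy (h0.trans (map_zero _).symm)
          exact (WithLp.toLp_eq_zero 2).1 this))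
      rw [← h, matrixForm_apply] at hpos
      refine hpos.trans_eq ?_
      simp only [dotProduct, Matrix.mulVec, Finset.mul_sum]
      refine Finset.sum_congr rfl fun i _ => Finset.sum_congr rfl fun j _ => ?_
      simp; ring

theorem mfderiv_symm_eq_comp (he : e ∈ atlas (EuclideanSpace ℝ (Fin n)) M)
    (he' : e' ∈ atlas (EuclideanSpace ℝ (Fin n)) M) {y : EuclideanSpace ℝ (Fin n)}
    (hy : y ∈ e'.target) (hy' : e'.symm y ∈ e.source) (u : EuclideanSpace ℝ (Fin n)) :
    (mfderiv (𝓡 n) (𝓡 n) e'.symm y u : EuclideanSpace ℝ (Fin n)) =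
      mfderiv (𝓡 n) (𝓡 n) e.symm (e (e'.symm y)) (fderiv ℝ (e ∘ e'.symm) y u) := by
  have hd := mdifferentiable_of_mem_atlas (I := 𝓡 n) he
  have hd' := mdifferentiable_of_mem_atlas (I := 𝓡 n) he'
  have h1 : MDifferentiableAt (𝓡 n) (𝓡 n) (e ∘ e'.symm) y :=
    (hd.mdifferentiableAt hy').comp y (hd'.mdifferentiableAt_symm hy)
  have h2 := mfderiv_comp y (hd.mdifferentiableAt_symm (e.map_source hy')) h1
  rw [← mfderiv_eq_fderiv]
  have hev : e'.symm =ᶠ[𝓝 y] e.symm ∘ (e ∘ e'.symm) := by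
    filter_upwards [(e'.continuousAt_symm hy).preimage_mem_nhds (e.open_source.mem_nhds hy')]
      with z hz
    exact (e.left_inv hz).symm
  rw [hev.mfderiv_eq]
  exact congrArg (fun L : EuclideanSpace ℝ (Fin n) →L[ℝ] EuclideanSpace ℝ (Fin n) => L u) h2

/-- The transformation of the components of the metric under a change of charts. -/
theorem matrixForm_chartGram_transform (g : Metric n M)
    (he : e ∈ atlas (EuclideanSpace ℝ (Fin n)) M)
    (he' : e' ∈ atlas (EuclideanSpace ℝ (Fin n)) M) {y : EuclideanSpace ℝ (Fin n)}
    (hy : y ∈ e'.target) (hy' : e'.symm y ∈ e.source) (u v : EuclideanSpace ℝ (Fin n)) :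
    matrixForm (chartGram g e' y) u v = matrixForm (chartGram g e ((e ∘ e'.symm) y))
      (fderiv ℝ (e ∘ e'.symm) y u) (fderiv ℝ (e ∘ e'.symm) y v) := by
  rw [matrixForm_chartGram, matrixForm_chartGram]
  have hp : ∀ p q : M, p = q → ∀ u v : EuclideanSpace ℝ (Fin n),
      g.inner p u v = g.inner q u v := by
    rintro p _ rfl u v; rfl
  refine (hp _ _ (e.left_inv hy').symm _ _).trans ?_
  exact congrArg₂ (fun a b : EuclideanSpace ℝ (Fin n) => g.inner (e.symm (e (e'.symm y))) a b)
    (mfderiv_symm_eq_comp he he' hy hy' u) (mfderiv_symm_eq_comp he he' hy hy' v)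

theorem contDiffAt_transition (he : e ∈ atlas (EuclideanSpace ℝ (Fin n)) M)
    (he' : e' ∈ atlas (EuclideanSpace ℝ (Fin n)) M) {y : EuclideanSpace ℝ (Fin n)}
    (hy : y ∈ e'.target) (hy' : e'.symm y ∈ e.source) : ContDiffAt ℝ ∞ (e ∘ e'.symm) y :=
  contMDiffAt_iff_contDiffAt.1 <|
    (contMDiffAt_of_mem_maximalAtlas (IsManifold.subset_maximalAtlas (I := 𝓡 n) he) hy').comp y
      (contMDiffAt_symm_of_mem_maximalAtlas (IsManifold.subset_maximalAtlas (I := 𝓡 n) he') hy)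

/-- The scalar curvature can be computed in any chart. -/
theorem scal_eq_coordScal (g : Metric n M) (he : e ∈ atlas (EuclideanSpace ℝ (Fin n)) M) {x : M}
    (hx : x ∈ e.source) : scal g x = coordScal (chartGram g e) (e x) := by
  have he' := chart_mem_atlas (EuclideanSpace ℝ (Fin n)) x
  have hxs := mem_chart_source (EuclideanSpace ℝ (Fin n)) x
  set e' := chartAt (EuclideanSpace ℝ (Fin n)) x with hd
  have hy : e' x ∈ e'.target := e'.map_source hxs
  have hinv : e'.symm (e' x) = x := e'.left_inv hxs
  have hy' : e'.symm (e' x) ∈ e.source := by rwa [hinv]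
  have h := coordScal_transform (φ := e ∘ e'.symm) (isMetricOn_chartGram g he)
    (isMetricOn_chartGram g he') hy (by simpa using e.map_source hy')
    ((contDiffAt_transition he he' hy hy').of_le (by norm_cast)) (by
      filter_upwards [e'.open_target.mem_nhds hy,
        (e'.continuousAt_symm hy).preimage_mem_nhds (e.open_source.mem_nhds hy')] with z hz hz'
      exact matrixForm_chartGram_transform g he he' hz hz')
  rw [scal, ← hd, h, Function.comp_apply, hinv]

/-- The definition changes chart from point to point. Invariance allows one fixed chart near `x`,
where the coordinate formula is smooth. -/
theorem continuous_scal (g : Metric n M) : Continuous (scal g) := by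
  rw [continuous_iff_continuousAt]
  intro x
  have he := chart_mem_atlas (EuclideanSpace ℝ (Fin n)) x
  have hx := mem_chart_source (EuclideanSpace ℝ (Fin n)) x
  set e := chartAt (EuclideanSpace ℝ (Fin n)) x
  have h : ContinuousAt (fun z => coordScal (chartGram g e) (e z)) x :=
    ContinuousAt.comp (g := coordScal (chartGram g e)) (((isMetricOn_chartGram g he).contDiffOn_coordScal.continuousOn).continuousAt
      (e.open_target.mem_nhds (e.map_source hx))) (e.continuousAt hx)
  refine h.congr ?_
  filter_upwards [e.open_source.mem_nhds hx] with z hz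
  exact (scal_eq_coordScal g he hz).symm

end Charts

/-! ### Comparison of chart volumes and local finiteness of the Riemannian volume -/

theorem measurableSet_target_inter_preimage_symm {n : ℕ} {M : Type*} [TopologicalSpace M]
    [MeasurableSpace M] [BorelSpace M] (e : OpenPartialHomeomorph M (EuclideanSpace ℝ (Fin n)))
    {A : Set M} (hA : MeasurableSet A) : MeasurableSet (e.target ∩ e.symm ⁻¹' A) := by
  have h := (continuousOn_iff_continuous_domRestrict.1 e.continuousOn_symm).measurable hA
  have h2 := MeasurableSet.subtype_image e.open_target.measurableSet h
  have h3 : e.target.domRestrict e.symm ⁻¹' A = Subtype.val ⁻¹' (e.symm ⁻¹' A) := rfl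
  rwa [h3, Subtype.image_preimage_coe] at h2

section Volume

variable {n : ℕ} {M : Type*} [TopologicalSpace M]
  [ChartedSpace (EuclideanSpace ℝ (Fin n)) M] [IsManifold (𝓡 n) ∞ M]
  [MeasurableSpace M] [BorelSpace M]
  {e e' : OpenPartialHomeomorph M (EuclideanSpace ℝ (Fin n))}

theorem det_stdMatrix (L : EuclideanSpace ℝ (Fin n) →L[ℝ] EuclideanSpace ℝ (Fin n)) :
    (stdMatrix L).det = L.det := by
  rw [ContinuousLinearMap.det, ← LinearMap.det_toMatrix (EuclideanSpace.basisFun (Fin n) ℝ).toBasis]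
  congr 1

theorem chartVolume_apply (g : Metric n M)
    (e : OpenPartialHomeomorph M (EuclideanSpace ℝ (Fin n))) {A : Set M} (hA : MeasurableSet A) :
    chartVolume g e A = ∫⁻ y in e.target ∩ e.symm ⁻¹' A,
      ENNReal.ofReal (Real.sqrt (chartGram g e y).det) := by
  have h1 : AEMeasurable e.symm (volume.restrict e.target) :=
    e.continuousOn_symm.aemeasurable e.open_target.measurableSet
  rw [chartVolume, Measure.map_apply_of_aemeasurable (h1.mono_ac
    (withDensity_absolutelyContinuous _ _)) hA, withDensity_apply', Measure.restrict_restrict']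
  · rw [inter_comm]
  · exact e.open_target.measurableSet

/-- This is the change of variables formula for the transition map, with `√det (JᵀGJ) = |det J| √det
G`. -/
theorem chartVolume_le (g : Metric n M) (he : e ∈ atlas (EuclideanSpace ℝ (Fin n)) M)
    (he' : e' ∈ atlas (EuclideanSpace ℝ (Fin n)) M) {A : Set M} (hA : MeasurableSet A)
    (hAe : A ⊆ e.source) : chartVolume g e' A ≤ chartVolume g e A := by
  rw [chartVolume_apply g e hA, chartVolume_apply g e' hA]
  set S := e'.target ∩ e'.symm ⁻¹' A
  have hS : MeasurableSet S := measurableSet_target_inter_preimage_symm e' hA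
  set φ := e ∘ e'.symm
  have hinj : InjOn φ S := fun y hy z hz h =>
    e'.symm.injOn hy.1 hz.1 (e.injOn (hAe hy.2) (hAe hz.2) h)
  have hφ : ∀ y ∈ S, HasFDerivWithinAt φ (fderiv ℝ φ y) S y := fun y hy =>
    ((contDiffAt_transition he he' hy.1 (hAe hy.2)).differentiableAt
      (by simp)).hasFDerivAt.hasFDerivWithinAt
  have himg : φ '' S ⊆ e.target ∩ e.symm ⁻¹' A := by
    rintro _ ⟨y, hy, rfl⟩
    refine ⟨e.map_source (hAe hy.2), ?_⟩
    simpa [φ, e.left_inv (hAe hy.2)] using hy.2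
  refine le_trans ?_ (lintegral_mono_set himg)
  rw [lintegral_image_eq_lintegral_abs_det_fderiv_mul volume hS hφ hinj]
  refine (setLIntegral_congr_fun hS fun y hy => ?_).le
  have h := matrix_eq_of_matrixForm (matrixForm_chartGram_transform g he he' hy.1 (hAe hy.2))
  rw [h, Matrix.det_mul, Matrix.det_mul, Matrix.det_transpose, det_stdMatrix,
    ← ENNReal.ofReal_mul (abs_nonneg _), ← Real.sqrt_sq_eq_abs, ← Real.sqrt_mul (sq_nonneg _)]
  congr 2
  ring

theorem riemannianVolume_apply_le (g : Metric n M) (he : e ∈ atlas (EuclideanSpace ℝ (Fin n)) M)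
    {A : Set M} (hA : MeasurableSet A) (hAe : A ⊆ e.source) :
    riemannianVolume g A ≤ chartVolume g e A := by
  have hs : MeasurableSet e.source := e.open_source.measurableSet
  -- A supremum of measures is not computed set by set, so it is bounded by one measure dominating
  -- every chart volume. The infinite multiple of counting measure makes the bound trivial off
  -- `e.source` and vanishes on subsets of it.
  have h : riemannianVolume g ≤
      chartVolume g e + (⊤ : ℝ≥0∞) • Measure.count.restrict e.sourceᶜ := by
    refine iSup_le fun x => Measure.le_iff.2 fun B hB => ?_
    rw [← measure_inter_add_sdiff B hs]
    simp only [Measure.coe_add, Pi.add_apply, Measure.smul_apply, smul_eq_mul]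
    refine add_le_add ((chartVolume_le g he (chart_mem_atlas _ x) (hB.inter hs)
      inter_subset_right).trans (measure_mono inter_subset_left)) ?_
    rw [Measure.restrict_apply hB, ← sdiff_eq]
    rcases (B \ e.source).eq_empty_or_nonempty with h0 | h0
    · simp [h0]
    · rw [ENNReal.top_mul (by simpa [Measure.count_eq_zero_iff] using h0.ne_empty)]
      exact le_top
  refine (h A).trans ?_
  simp only [Measure.coe_add, Pi.add_apply, Measure.smul_apply, smul_eq_mul]
  rw [Measure.restrict_apply hA, ← sdiff_eq, sdiff_eq_empty.2 hAe]
  simp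

instance isLocallyFiniteMeasure_riemannianVolume (g : Metric n M) :
    IsLocallyFiniteMeasure (riemannianVolume g) := by
  refine ⟨fun x => ?_⟩
  have he := chart_mem_atlas (EuclideanSpace ℝ (Fin n)) x
  have hx := mem_chart_source (EuclideanSpace ℝ (Fin n)) x
  set e := chartAt (EuclideanSpace ℝ (Fin n)) x
  have hx' := e.map_source hx
  have hG := isMetricOn_chartGram g he
  have hc : ContinuousOn (fun y => (chartGram g e y).det) e.target :=
    (contDiffOn_det hG.contDiffOn).continuousOn
  -- By continuity the determinant stays below its value at `x` plus one on a small ball, which has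
  -- finite Lebesgue measure.
  have hcx := (hc.continuousAt (e.open_target.mem_nhds hx')).eventually_lt_const
    (lt_add_one (chartGram g e (e x)).det)
  obtain ⟨r, hr, hball⟩ := _root_.Metric.mem_nhds_iff.1
    (inter_mem (e.open_target.mem_nhds hx') hcx)
  set V := e.source ∩ e ⁻¹' _root_.Metric.ball (e x) r
  have hVo : IsOpen V := e.isOpen_inter_preimage _root_.Metric.isOpen_ball
  refine ⟨V, hVo.mem_nhds ⟨hx, _root_.Metric.mem_ball_self hr⟩, ?_⟩
  refine (riemannianVolume_apply_le g he hVo.measurableSet inter_subset_left).trans_lt ?_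
  rw [chartVolume_apply g e hVo.measurableSet]
  have hsub : e.target ∩ e.symm ⁻¹' V ⊆ _root_.Metric.ball (e x) r := by
    rintro y ⟨hy, hy'⟩
    simpa [e.right_inv hy] using hy'.2
  refine (lintegral_mono_set hsub).trans_lt ?_
  calc _ ≤ ∫⁻ y in _root_.Metric.ball (e x) r,
        ENNReal.ofReal (Real.sqrt ((chartGram g e (e x)).det + 1)) :=
        setLIntegral_mono measurable_const fun y hy =>
          ENNReal.ofReal_le_ofReal (Real.sqrt_le_sqrt (hball hy).2.le)
    _ < ⊤ := by
      rw [setLIntegral_const]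
      exact ENNReal.mul_lt_top ENNReal.ofReal_lt_top measure_ball_lt_top

end Volume

/-! ### The norm of the differential in coordinates -/

section NormDiff

/-- The norm of a linear form in terms of its values on a basis. -/
theorem norm_sq_linearForm {n : ℕ} {F : Type*} [NormedAddCommGroup F] [InnerProductSpace ℝ F]
    [CompleteSpace F] (b : Module.Basis (Fin n) ℝ F) (L : F →L[ℝ] ℝ)
    {A : Matrix (Fin n) (Fin n) ℝ}
    (hA : ∀ i j, A i j = inner ℝ (b i) (b j)) (hdet : A.det ≠ 0) :
    ‖L‖ ^ 2 = ∑ i, ∑ j, A⁻¹ i j * (L (b i) * L (b j)) := by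
  set w := (InnerProductSpace.toDual ℝ F).symm L
  have hw : ∀ x, L x = inner ℝ w x := fun x => by simp [w]
  have hnorm : ‖L‖ = ‖w‖ := by simp [w]
  have hrep : ∑ i, b.repr w i • b i = w := b.sum_repr w
  set c : Fin n → ℝ := fun i => b.repr w i
  -- The Riesz vector `w` of `L` has coordinates `c = A⁻¹ (L b)`, and `‖L‖² = L w = ∑ L (b i) c i`.
  have hL : (fun i => L (b i)) = A *ᵥ c := by
    ext i
    rw [hw, ← hrep, sum_inner, Matrix.mulVec, dotProduct]
    refine Finset.sum_congr rfl fun j _ => ?_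
    rw [inner_smul_left, hA, real_inner_comm]
    simp [c, mul_comm]
  have h1 : ∑ i, ∑ j, A⁻¹ i j * (L (b i) * L (b j)) =
      (fun i => L (b i)) ⬝ᵥ (A⁻¹ *ᵥ (fun i => L (b i))) := by
    simp only [dotProduct, Matrix.mulVec, Finset.mul_sum]
    refine Finset.sum_congr rfl fun i _ => Finset.sum_congr rfl fun j _ => ?_
    ring
  rw [h1]
  nth_rewrite 2 [hL]
  rw [Matrix.mulVec_mulVec, Matrix.nonsing_inv_mul _ hdet.isUnit, Matrix.one_mulVec, hnorm,
    ← real_inner_self_eq_norm_sq, ← hw]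
  have hLw : L (∑ i, b.repr w i • b i) = ∑ i, L (b i) * c i := by
    simp only [map_sum, map_smul, smul_eq_mul, c, mul_comm]
  rwa [hrep] at hLw

variable {n : ℕ} {M : Type*} [TopologicalSpace M]
  [ChartedSpace (EuclideanSpace ℝ (Fin n)) M] [IsManifold (𝓡 n) ∞ M]
  {e : OpenPartialHomeomorph M (EuclideanSpace ℝ (Fin n))}

/-- The formula `|dv|² = gⁱʲ ∂ᵢv ∂ⱼv` reduces the operator norm on the tangent space to ordinary
calculus. The coordinate vectors form a basis whose Gram matrix is `chartGram`. -/
theorem normDiff_symm_sq (g : Metric n M) (he : e ∈ atlas (EuclideanSpace ℝ (Fin n)) M)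
    {v : M → ℝ} {y : EuclideanSpace ℝ (Fin n)} (hy : y ∈ e.target)
    (hv : MDifferentiableAt (𝓡 n) 𝓘(ℝ, ℝ) v (e.symm y)) :
    normDiff g v (e.symm y) ^ 2 = ∑ i, ∑ j, (chartGram g e y)⁻¹ i j *
      (partialDeriv i (v ∘ e.symm) y * partialDeriv j (v ∘ e.symm) y) := by
  let : RiemannianBundle (fun x : M => TangentSpace (𝓡 n) x) := ⟨g.toRiemannianMetric⟩
  have : FiniteDimensional ℝ (TangentSpace (𝓡 n) (e.symm y)) :=
    inferInstanceAs (FiniteDimensional ℝ (EuclideanSpace ℝ (Fin n)))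
  have : CompleteSpace (TangentSpace (𝓡 n) (e.symm y)) := FiniteDimensional.complete ℝ _
  have hbij : Function.Bijective (mfderiv (𝓡 n) (𝓡 n) e.symm y) :=
    (mdifferentiable_of_mem_atlas (I := 𝓡 n) he).symm.mfderiv_bijective hy
  let D : EuclideanSpace ℝ (Fin n) ≃ₗ[ℝ] TangentSpace (𝓡 n) (e.symm y) :=
    LinearEquiv.ofBijective (mfderiv (𝓡 n) (𝓡 n) e.symm y).toLinearMap hbij
  let b : Module.Basis (Fin n) ℝ (TangentSpace (𝓡 n) (e.symm y)) :=
    (EuclideanSpace.basisFun (Fin n) ℝ).toBasis.map D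
  have hb : ∀ i, b i = mfderiv (𝓡 n) (𝓡 n) e.symm y (EuclideanSpace.single i (1 : ℝ)) := by
    intro i
    change D ((EuclideanSpace.basisFun (Fin n) ℝ).toBasis i) = _
    rw [OrthonormalBasis.coe_toBasis, EuclideanSpace.basisFun_apply]
    rfl
  have hL : ∀ i, (mfderiv (𝓡 n) 𝓘(ℝ, ℝ) v (e.symm y) (b i) : ℝ) =
      partialDeriv i (v ∘ e.symm) y := by
    intro i
    rw [partialDeriv, ← mfderiv_eq_fderiv, mfderiv_comp y hv
      ((mdifferentiable_of_mem_atlas (I := 𝓡 n) he).mdifferentiableAt_symm hy), hb]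
    rfl
  have h := norm_sq_linearForm b
    (mfderiv (𝓡 n) 𝓘(ℝ, ℝ) v (e.symm y) : TangentSpace (𝓡 n) (e.symm y) →L[ℝ] ℝ)
    (A := chartGram g e y) (fun i j => by rw [hb, hb]; rfl)
    ((isMetricOn_chartGram g he).det_ne_zero hy)
  refine Eq.trans h ?_
  refine Finset.sum_congr rfl fun i _ => Finset.sum_congr rfl fun j _ => ?_
  rw [← hL, ← hL]
  rfl

theorem normDiff_sq (g : Metric n M) (he : e ∈ atlas (EuclideanSpace ℝ (Fin n)) M)
    {v : M → ℝ} {x : M} (hx : x ∈ e.source) (hv : MDifferentiableAt (𝓡 n) 𝓘(ℝ, ℝ) v x) :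
    normDiff g v x ^ 2 = ∑ i, ∑ j, (chartGram g e (e x))⁻¹ i j *
      (partialDeriv i (v ∘ e.symm) (e x) * partialDeriv j (v ∘ e.symm) (e x)) := by
  have h := normDiff_symm_sq (v := v) g he (e.map_source hx) (by rwa [e.left_inv hx])
  rwa [e.left_inv hx] at h

theorem normDiff_congr (g : Metric n M) {v w : M → ℝ} {x : M} (h : v =ᶠ[𝓝 x] w) :
    normDiff g v x = normDiff g w x := by
  unfold normDiff
  rw [h.mfderiv_eq]

theorem normDiff_eq_zero (g : Metric n M) {v : M → ℝ} {x : M} (h : x ∉ tsupport v) :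
    normDiff g v x = 0 := by
  rw [normDiff_congr g (notMem_tsupport_iff_eventuallyEq.1 h)]
  have := normDiff_sq (v := (0 : M → ℝ)) g (chart_mem_atlas (EuclideanSpace ℝ (Fin n)) x)
    (mem_chart_source _ x) mdifferentiableAt_const
  rw [← sq_eq_zero_iff, this]
  simp [partialDeriv]

theorem contDiffOn_comp_symm (he : e ∈ atlas (EuclideanSpace ℝ (Fin n)) M)
    {v : M → ℝ} (hv : ContMDiff (𝓡 n) 𝓘(ℝ, ℝ) ∞ v) : ContDiffOn ℝ ∞ (v ∘ e.symm) e.target :=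
  contMDiffOn_iff_contDiffOn.1 <| hv.comp_contMDiffOn <|
    contMDiffOn_symm_of_mem_maximalAtlas (IsManifold.subset_maximalAtlas he)

theorem continuous_normDiff_sq (g : Metric n M) {v : M → ℝ}
    (hv : ContMDiff (𝓡 n) 𝓘(ℝ, ℝ) ∞ v) : Continuous fun x => normDiff g v x ^ 2 := by
  rw [continuous_iff_continuousAt]
  intro x
  have he := chart_mem_atlas (EuclideanSpace ℝ (Fin n)) x
  have hx := mem_chart_source (EuclideanSpace ℝ (Fin n)) x
  set e := chartAt (EuclideanSpace ℝ (Fin n)) x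
  have hG := isMetricOn_chartGram g he
  have hp := fun i => contDiffOn_partialDeriv hG.isOpen (contDiffOn_comp_symm he hv) i
  have h : ContDiffOn ℝ ∞ (fun y => ∑ i, ∑ j, (chartGram g e y)⁻¹ i j *
      (partialDeriv i (v ∘ e.symm) y * partialDeriv j (v ∘ e.symm) y)) e.target :=
    ContDiffOn.sum fun i _ => ContDiffOn.sum fun j _ =>
      (hG.contDiffOn_inv i j).mul ((hp i).mul (hp j))
  refine (ContinuousAt.comp (f := e) (h.continuousOn.continuousAt
    (e.open_target.mem_nhds (e.map_source hx))) (e.continuousAt hx)).congr ?_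
  filter_upwards [e.open_source.mem_nhds hx] with z hz
  exact (normDiff_sq g he hz (hv.mdifferentiable (by simp) z)).symm

theorem normDiff_smul_sq (g : Metric n M) {v : M → ℝ} (hv : ContMDiff (𝓡 n) 𝓘(ℝ, ℝ) ∞ v) (c : ℝ)
    (x : M) : normDiff g (fun x => c * v x) x ^ 2 = c ^ 2 * normDiff g v x ^ 2 := by
  have he := chart_mem_atlas (EuclideanSpace ℝ (Fin n)) x
  have hx := mem_chart_source (EuclideanSpace ℝ (Fin n)) x
  set e := chartAt (EuclideanSpace ℝ (Fin n)) x
  have hcv : ContMDiff (𝓡 n) 𝓘(ℝ, ℝ) ∞ (fun x => c * v x) := contMDiff_const.mul hv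
  rw [normDiff_sq g he hx (hv.mdifferentiable (by simp) x),
    normDiff_sq g he hx (hcv.mdifferentiable (by simp) x), Finset.mul_sum]
  have hp : ∀ i, partialDeriv i ((fun x => c * v x) ∘ e.symm) (e x) =
      c * partialDeriv i (v ∘ e.symm) (e x) := by
    intro i
    have hd : DifferentiableAt ℝ (v ∘ e.symm) (e x) :=
      ((contDiffOn_comp_symm he hv).contDiffAt (e.open_target.mem_nhds
        (e.map_source hx))).differentiableAt (by simp)
    have := fderiv_const_mul hd c
    simp only [partialDeriv]
    rw [show (fun x => c * v x) ∘ e.symm = fun y => c * (v ∘ e.symm) y from rfl, this]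
    simp
  refine Finset.sum_congr rfl fun i _ => ?_
  rw [Finset.mul_sum]
  refine Finset.sum_congr rfl fun j _ => ?_
  rw [hp, hp]
  ring

/-- The squares of the norms of the differentials of `sin f * v` and `cos f * v` add up to
`|dv|² + v² |df|²`. -/
theorem normDiff_sin_cos (g : Metric n M) {v f : M → ℝ} (hv : ContMDiff (𝓡 n) 𝓘(ℝ, ℝ) ∞ v)
    (hf : ContMDiff (𝓡 n) 𝓘(ℝ, ℝ) ∞ f) (x : M) :
    normDiff g (fun x => Real.sin (f x) * v x) x ^ 2 +
      normDiff g (fun x => Real.cos (f x) * v x) x ^ 2 =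
        normDiff g v x ^ 2 + v x ^ 2 * normDiff g f x ^ 2 := by
  have he := chart_mem_atlas (EuclideanSpace ℝ (Fin n)) x
  have hx := mem_chart_source (EuclideanSpace ℝ (Fin n)) x
  set e := chartAt (EuclideanSpace ℝ (Fin n)) x
  have hs : ContMDiff (𝓡 n) 𝓘(ℝ, ℝ) ∞ (fun x => Real.sin (f x) * v x) :=
    (Real.contDiff_sin.contMDiff.comp hf).mul hv
  have hc : ContMDiff (𝓡 n) 𝓘(ℝ, ℝ) ∞ (fun x => Real.cos (f x) * v x) :=
    (Real.contDiff_cos.contMDiff.comp hf).mul hv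
  have hdv : DifferentiableAt ℝ (v ∘ e.symm) (e x) :=
    ((contDiffOn_comp_symm he hv).contDiffAt (e.open_target.mem_nhds
      (e.map_source hx))).differentiableAt (by simp)
  have hdf : DifferentiableAt ℝ (f ∘ e.symm) (e x) :=
    ((contDiffOn_comp_symm he hf).contDiffAt (e.open_target.mem_nhds
      (e.map_source hx))).differentiableAt (by simp)
  have hps : ∀ i, partialDeriv i ((fun x => Real.sin (f x) * v x) ∘ e.symm) (e x) =
      Real.sin (f x) * partialDeriv i (v ∘ e.symm) (e x) +
        v x * Real.cos (f x) * partialDeriv i (f ∘ e.symm) (e x) := by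
    intro i
    have h := (hdf.hasFDerivAt.sin.mul hdv.hasFDerivAt).fderiv
    simp only [partialDeriv]
    refine (congrArg (fun L : EuclideanSpace ℝ (Fin n) →L[ℝ] ℝ =>
      L (EuclideanSpace.single i 1)) h).trans ?_
    simp [e.left_inv hx]
    ring
  have hpc : ∀ i, partialDeriv i ((fun x => Real.cos (f x) * v x) ∘ e.symm) (e x) =
      Real.cos (f x) * partialDeriv i (v ∘ e.symm) (e x) -
        v x * Real.sin (f x) * partialDeriv i (f ∘ e.symm) (e x) := by
    intro i
    have h := (hdf.hasFDerivAt.cos.mul hdv.hasFDerivAt).fderiv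
    simp only [partialDeriv]
    refine (congrArg (fun L : EuclideanSpace ℝ (Fin n) →L[ℝ] ℝ =>
      L (EuclideanSpace.single i 1)) h).trans ?_
    simp [e.left_inv hx]
    ring
  rw [normDiff_sq g he hx (hv.mdifferentiable (by simp) x),
    normDiff_sq g he hx (hf.mdifferentiable (by simp) x),
    normDiff_sq g he hx (hs.mdifferentiable (by simp) x),
    normDiff_sq g he hx (hc.mdifferentiable (by simp) x)]
  simp only [hps, hpc, Finset.mul_sum, ← Finset.sum_add_distrib]
  refine Finset.sum_congr rfl fun i _ => Finset.sum_congr rfl fun j _ => ?_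
  -- The mixed terms `v sin f cos f ∂v ∂f` occur with opposite signs in the two squares.
  linear_combination (chartGram g e (e x))⁻¹ i j *
    (partialDeriv i (v ∘ e.symm) (e x) * partialDeriv j (v ∘ e.symm) (e x) +
      v x ^ 2 * (partialDeriv i (f ∘ e.symm) (e x) * partialDeriv j (f ∘ e.symm) (e x))) *
        Real.sin_sq_add_cos_sq (f x)

end NormDiff

/-! ### Energy, critical norm and the Hölder lower bound -/

section Functional

/-- The critical Sobolev exponent `p = 2n / (n - 2)`. -/
abbrev critExp (n : ℕ) : ℝ≥0∞ := ENNReal.ofReal (2 * (n : ℝ) / ((n : ℝ) - 2))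

/-- The coefficient `aₙ = 4(n - 1) / (n - 2)`. -/
abbrev dirichletCoeff (n : ℕ) : ℝ := 4 * ((n : ℝ) - 1) / ((n : ℝ) - 2)

theorem two_lt_cast {n : ℕ} (hn : 3 ≤ n) : (2 : ℝ) < n := by
  have : (3 : ℝ) ≤ n := by exact_mod_cast hn
  linarith

theorem dirichletCoeff_pos {n : ℕ} (hn : 3 ≤ n) : 0 < dirichletCoeff n := by
  have := two_lt_cast hn
  exact div_pos (by linarith) (by linarith)

theorem critExp_real_pos {n : ℕ} (hn : 3 ≤ n) : 0 < 2 * (n : ℝ) / ((n : ℝ) - 2) := by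
  have := two_lt_cast hn
  exact div_pos (by linarith) (by linarith)

/-- Hölder's inequality for the exponents `n/2`, `p`, `p`. -/
theorem integral_mul_sq_le {α : Type*} [MeasurableSpace α] {μ : Measure α} {n : ℕ} (hn : 3 ≤ n)
    {h v : α → ℝ} (hh0 : ∀ x, 0 ≤ h x) (hh : AEStronglyMeasurable h μ)
    (hhn : eLpNorm h ((n : ℝ≥0∞) / 2) μ ≠ ⊤) (hv : MemLp v (critExp n) μ) :
    ∫ x, h x * v x ^ 2 ∂μ ≤ (eLpNorm h ((n : ℝ≥0∞) / 2) μ).toReal *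
      (eLpNorm v (critExp n) μ).toReal ^ 2 := by
  have h2 := two_lt_cast hn
  have hn0 : (n : ℝ≥0∞) / 2 = ENNReal.ofReal ((n : ℝ) / 2) := by
    rw [ENNReal.ofReal_div_of_pos two_pos]; simp
  -- Two factors at a time: `h v` lies in the space of exponent `2n/(n+2)`, because `2/n +
  -- (n-2)/(2n) = (n+2)/(2n)`. This exponent is conjugate to `p`.
  have t1 : ENNReal.HolderTriple ((n : ℝ≥0∞) / 2) (critExp n)
      (ENNReal.ofReal (2 * n / (n + 2))) := by
    refine ⟨?_⟩
    rw [hn0, ← ENNReal.ofReal_inv_of_pos (by linarith),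
      ← ENNReal.ofReal_inv_of_pos (critExp_real_pos hn),
      ← ENNReal.ofReal_inv_of_pos (by positivity), ← ENNReal.ofReal_add (by positivity)
      (inv_nonneg.2 (critExp_real_pos hn).le)]
    congr 1
    field_simp
    ring
  have t2 : ENNReal.HolderTriple (ENNReal.ofReal (2 * n / (n + 2))) (critExp n) 1 := by
    refine ⟨?_⟩
    rw [← ENNReal.ofReal_inv_of_pos (critExp_real_pos hn),
      ← ENNReal.ofReal_inv_of_pos (by positivity), ← ENNReal.ofReal_add (by positivity)
      (inv_nonneg.2 (critExp_real_pos hn).le), inv_one, ← ENNReal.ofReal_one]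
    congr 1
    field_simp
    ring
  have e1 := eLpNorm_smul_le_mul_eLpNorm hv.1 hh (hpqr := t1)
  have e2 := eLpNorm_smul_le_mul_eLpNorm hv.1 (hh.smul hv.1) (hpqr := t2)
  have e3 : eLpNorm (fun x => h x * v x ^ 2) 1 μ ≤ eLpNorm h ((n : ℝ≥0∞) / 2) μ *
      eLpNorm v (critExp n) μ ^ 2 := by
    have : (fun x => h x * v x ^ 2) = (h • v) • v := by
      ext x; simp [sq, mul_assoc]
    rw [this, sq, ← mul_assoc]
    exact e2.trans (mul_le_mul_left e1 _)
  rw [integral_eq_lintegral_of_nonneg_ae (Eventually.of_forall fun x =>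
    mul_nonneg (hh0 x) (sq_nonneg _)) (hh.mul (hv.1.pow 2)), ← ENNReal.toReal_pow,
    ← ENNReal.toReal_mul]
  refine ENNReal.toReal_mono (ENNReal.mul_ne_top hhn (ENNReal.pow_ne_top hv.2.ne)) ?_
  refine le_trans (le_of_eq ?_) e3
  rw [eLpNorm_one_eq_lintegral_enorm]
  refine lintegral_congr fun x => ?_
  rw [Real.enorm_eq_ofReal (mul_nonneg (hh0 x) (sq_nonneg _))]

/-- Smooth functions with compact support. -/
structure IsSmoothCompact (n : ℕ) {M : Type*} [TopologicalSpace M]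
    [ChartedSpace (EuclideanSpace ℝ (Fin n)) M] (v : M → ℝ) : Prop where
  smooth : ContMDiff (𝓡 n) 𝓘(ℝ, ℝ) ∞ v
  hasCompactSupport : HasCompactSupport v

theorem IsTestFunction.isSmoothCompact {n : ℕ} {M : Type*} [TopologicalSpace M]
    [ChartedSpace (EuclideanSpace ℝ (Fin n)) M] {U : Set M} {v : M → ℝ}
    (hv : IsTestFunction n U v) : IsSmoothCompact n v := ⟨hv.smooth, hv.hasCompactSupport⟩

variable {n : ℕ} {M : Type*} [TopologicalSpace M]
  [ChartedSpace (EuclideanSpace ℝ (Fin n)) M] [IsManifold (𝓡 n) ∞ M]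

/-- The integrand of the Yamabe functional. -/
def energyDensity (g : Metric n M) (v : M → ℝ) (x : M) : ℝ :=
  dirichletCoeff n * normDiff g v x ^ 2 + scal g x * v x ^ 2

theorem continuous_scalNeg (g : Metric n M) : Continuous (scalNeg g) :=
  (continuous_const.min (continuous_scal g)).neg

theorem scalNeg_nonneg (g : Metric n M) (x : M) : 0 ≤ scalNeg g x :=
  neg_nonneg.2 (min_le_left _ _)

theorem neg_scalNeg_le (g : Metric n M) (x : M) : -scalNeg g x ≤ scal g x := by
  simp [scalNeg]

theorem IsSmoothCompact.continuous_energyDensity {v : M → ℝ} (hv : IsSmoothCompact n v)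
    (g : Metric n M) : Continuous (energyDensity g v) :=
  (continuous_const.mul (continuous_normDiff_sq g hv.smooth)).add
    ((continuous_scal g).mul (hv.smooth.continuous.pow 2))

theorem energyDensity_eq_zero (g : Metric n M) {v : M → ℝ} {x : M} (hx : x ∉ tsupport v) :
    energyDensity g v x = 0 := by
  simp [energyDensity, normDiff_eq_zero g hx, image_eq_zero_of_notMem_tsupport hx]

theorem energyDensity_congr (g : Metric n M) {v w : M → ℝ} {x : M} (h : v =ᶠ[𝓝 x] w) :
    energyDensity g v x = energyDensity g w x := by
  simp [energyDensity, normDiff_congr g h, h.self_of_nhds]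

variable [MeasurableSpace M]

/-- The numerator of the Yamabe functional. -/
def energy (g : Metric n M) (v : M → ℝ) : ℝ := ∫ x, energyDensity g v x ∂(riemannianVolume g)

/-- The `Lᵖ` norm for the critical exponent. -/
def critNorm (g : Metric n M) (v : M → ℝ) : ℝ :=
  (eLpNorm v (critExp n) (riemannianVolume g)).toReal

theorem functional_eq (g : Metric n M) (v : M → ℝ) :
    functional g v = energy g v / critNorm g v ^ 2 := rfl

theorem critNorm_nonneg (g : Metric n M) (v : M → ℝ) : 0 ≤ critNorm g v := ENNReal.toReal_nonneg

theorem energy_smul (g : Metric n M) {v : M → ℝ} (hv : ContMDiff (𝓡 n) 𝓘(ℝ, ℝ) ∞ v) (c : ℝ) :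
    energy g (fun x => c * v x) = c ^ 2 * energy g v := by
  rw [energy, energy, ← integral_const_mul]
  refine integral_congr_ae (Eventually.of_forall fun x => ?_)
  simp only [energyDensity, normDiff_smul_sq g hv]
  ring

theorem critNorm_smul (g : Metric n M) (v : M → ℝ) (c : ℝ) :
    critNorm g (fun x => c * v x) = |c| * critNorm g v := by
  have := eLpNorm_const_smul c v (critExp n) (riemannianVolume g)
  rw [critNorm, show (fun x => c * v x) = c • v from rfl, this, ENNReal.toReal_mul, critNorm]
  simp

theorem neg_le_functional {g : Metric n M} {v : M → ℝ} {C : ℝ} (hC : 0 ≤ C)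
    (h : -C * critNorm g v ^ 2 ≤ energy g v) : -C ≤ functional g v := by
  rw [functional_eq]
  rcases (sq_nonneg (critNorm g v)).eq_or_lt with h0 | h0
  -- A quotient with vanishing norm is `0` by convention, which is at least `-C`.
  · rw [← h0, div_zero]; linarith
  · rwa [le_div_iff₀ h0]

theorem yamabeConstant_le_atInfinity (g : Metric n M) (K : CompactExhaustion M) :
    yamabeConstant g ≤ yamabeConstantAtInfinity g K :=
  ge_of_tendsto' (tendsto_yamabeConstantAtInfinity g K) fun _ =>
    yamabeConstantOn_anti g (subset_univ _)

variable [BorelSpace M]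

namespace IsSmoothCompact

variable {v : M → ℝ}

theorem memLp (hv : IsSmoothCompact n v) (g : Metric n M) (p : ℝ≥0∞) :
    MemLp v p (riemannianVolume g) :=
  hv.smooth.continuous.memLp_of_hasCompactSupport hv.hasCompactSupport

variable [T2Space M]

theorem integrable_energyDensity (hv : IsSmoothCompact n v) (g : Metric n M) :
    Integrable (energyDensity g v) (riemannianVolume g) :=
  (hv.continuous_energyDensity g).integrable_of_hasCompactSupport
    (HasCompactSupport.intro hv.hasCompactSupport fun _ hx => energyDensity_eq_zero g hx)

theorem integrable_mul_sq (hv : IsSmoothCompact n v) (g : Metric n M) {h : M → ℝ}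
    (hh : Continuous h) : Integrable (fun x => h x * v x ^ 2) (riemannianVolume g) :=
  (hh.mul (hv.smooth.continuous.pow 2)).integrable_of_hasCompactSupport
    (HasCompactSupport.intro hv.hasCompactSupport fun _ hx => by
      simp [image_eq_zero_of_notMem_tsupport hx])

theorem neg_integral_scalNeg_le_energy (hn : 3 ≤ n) (hv : IsSmoothCompact n v) (g : Metric n M) :
    -∫ x, scalNeg g x * v x ^ 2 ∂(riemannianVolume g) ≤ energy g v := by
  rw [← integral_neg]
  refine integral_mono (hv.integrable_mul_sq g (continuous_scalNeg g)).neg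
    (hv.integrable_energyDensity g) fun x => ?_
  have h1 := mul_nonneg (dirichletCoeff_pos hn).le (sq_nonneg (normDiff g v x))
  have h2 := mul_le_mul_of_nonneg_right (neg_scalNeg_le g x) (sq_nonneg (v x))
  simp only [energyDensity]
  linarith

theorem neg_mul_critNorm_sq_le_energy (hn : 3 ≤ n) (hv : IsSmoothCompact n v) (g : Metric n M)
    (hfin : eLpNorm (scalNeg g) ((n : ℝ≥0∞) / 2) (riemannianVolume g) ≠ ⊤) :
    -(eLpNorm (scalNeg g) ((n : ℝ≥0∞) / 2) (riemannianVolume g)).toReal * critNorm g v ^ 2 ≤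
      energy g v := by
  refine le_trans ?_ (hv.neg_integral_scalNeg_le_energy hn g)
  rw [neg_mul, neg_le_neg_iff]
  exact integral_mul_sq_le hn (scalNeg_nonneg g) (continuous_scalNeg g).aestronglyMeasurable hfin
    (hv.memLp g _)

end IsSmoothCompact

variable [T2Space M]

/-- The lower bound of the Yamabe constant by the norm of the negative part of the scalar
curvature. -/
theorem neg_eLpNorm_scalNeg_le_yamabeConstant (hn : 3 ≤ n) (g : Metric n M) :
    -((eLpNorm (scalNeg g) ((n : ℝ≥0∞) / 2) (riemannianVolume g) : ℝ≥0∞) : EReal) ≤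
      yamabeConstant g := by
  by_cases hfin : eLpNorm (scalNeg g) ((n : ℝ≥0∞) / 2) (riemannianVolume g) = ⊤
  · simp [hfin]
  · refine le_iInf₂ fun v hv => ?_
    rw [← EReal.coe_ennreal_toReal hfin, ← EReal.coe_neg, EReal.coe_le_coe_iff]
    exact neg_le_functional ENNReal.toReal_nonneg
      (hv.isSmoothCompact.neg_mul_critNorm_sq_le_energy hn g hfin)

end Functional

/-! ### Sums with disjoint supports: a negative constant at infinity is infinite -/

/-- Equality of germs, not only of values, is needed because the energy density involves the
differential. -/
theorem eventuallyEq_add_of_disjoint_tsupport {X : Type*} [TopologicalSpace X] {v w : X → ℝ}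
    (h : Disjoint (tsupport v) (tsupport w)) (x : X) :
    (v =ᶠ[𝓝 x] 0 ∧ v + w =ᶠ[𝓝 x] w) ∨ (w =ᶠ[𝓝 x] 0 ∧ v + w =ᶠ[𝓝 x] v) := by
  by_cases hx : x ∈ tsupport v
  · have := notMem_tsupport_iff_eventuallyEq.1 (disjoint_left.1 h hx)
    exact Or.inr ⟨this, by filter_upwards [this] with y hy; simp [hy]⟩
  · have := notMem_tsupport_iff_eventuallyEq.1 hx
    exact Or.inl ⟨this, by filter_upwards [this] with y hy; simp [hy]⟩

section DisjointSupports

variable {n : ℕ} {M : Type*} [TopologicalSpace M]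
  [ChartedSpace (EuclideanSpace ℝ (Fin n)) M]

theorem IsSmoothCompact.add {v w : M → ℝ} (hv : IsSmoothCompact n v) (hw : IsSmoothCompact n w) :
    IsSmoothCompact n (v + w) :=
  ⟨hv.smooth.add hw.smooth, hv.hasCompactSupport.add hw.hasCompactSupport⟩

theorem IsTestFunction.smul {U : Set M} {v : M → ℝ} (hv : IsTestFunction n U v) {c : ℝ}
    (hc : 0 < c) : IsTestFunction n U (fun x => c * v x) where
  smooth := contMDiff_const.mul hv.smooth
  hasCompactSupport := hv.hasCompactSupport.mul_left
  tsupport_subset := (tsupport_mul_subset_right).trans hv.tsupport_subset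
  nonneg x := mul_nonneg hc.le (hv.nonneg x)
  ne_zero h := hv.ne_zero (funext fun x => by
    have := congrFun h x
    simpa [hc.ne'] using this)

theorem IsTestFunction.mono {U V : Set M} {v : M → ℝ} (hv : IsTestFunction n U v) (h : U ⊆ V) :
    IsTestFunction n V v :=
  ⟨hv.smooth, hv.hasCompactSupport, hv.tsupport_subset.trans h, hv.nonneg, hv.ne_zero⟩

theorem IsTestFunction.add {U : Set M} {v w : M → ℝ} (hv : IsTestFunction n U v)
    (hw : IsTestFunction n U w) : IsTestFunction n U (v + w) where
  smooth := hv.smooth.add hw.smooth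
  hasCompactSupport := hv.hasCompactSupport.add hw.hasCompactSupport
  tsupport_subset := (tsupport_add v w).trans (union_subset hv.tsupport_subset hw.tsupport_subset)
  nonneg x := add_nonneg (hv.nonneg x) (hw.nonneg x)
  ne_zero h := hv.ne_zero (funext fun x => by
    have h0 : v x + w x = 0 := congrFun h x
    have h1 := hv.nonneg x
    have h2 := hw.nonneg x
    change v x = 0
    linarith)

variable [IsManifold (𝓡 n) ∞ M] [MeasurableSpace M]

theorem critNorm_pos_of_functional_neg {g : Metric n M} {v : M → ℝ} (h : functional g v < 0) :
    0 < critNorm g v := by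
  refine (critNorm_nonneg g v).lt_of_ne fun h0 => h.ne ?_
  rw [functional_eq, ← h0]
  simp

/-- The functional is invariant under positive scaling, and a negative value forces a nonzero norm.
-/
theorem IsTestFunction.exists_normalized {U : Set M} {v : M → ℝ} {g : Metric n M} {c : ℝ}
    (hc : 0 ≤ c) (hv : IsTestFunction n U v) (h : functional g v < -c) :
    ∃ w, IsTestFunction n U w ∧ energy g w ≤ -c ∧ critNorm g w = 1 := by
  have hpos := critNorm_pos_of_functional_neg (h.trans_le (neg_nonpos.2 hc))
  refine ⟨fun x => (critNorm g v)⁻¹ * v x, hv.smul (inv_pos.2 hpos), ?_, ?_⟩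
  · rw [energy_smul g hv.smooth, inv_pow, inv_mul_eq_div]
    exact h.le
  · rw [critNorm_smul, abs_of_pos (inv_pos.2 hpos), inv_mul_cancel₀ hpos.ne']

variable [BorelSpace M]

theorem IsSmoothCompact.critNorm_rpow (hn : 3 ≤ n) {v : M → ℝ} (hv : IsSmoothCompact n v)
    (g : Metric n M) :
    critNorm g v ^ (2 * (n : ℝ) / (n - 2)) =
      ∫ x, ‖v x‖ ^ (2 * (n : ℝ) / (n - 2)) ∂(riemannianVolume g) := by
  have hq := critExp_real_pos hn
  have h0 : 0 ≤ ∫ x, ‖v x‖ ^ (2 * (n : ℝ) / (n - 2)) ∂(riemannianVolume g) :=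
    integral_nonneg fun x => by positivity
  rw [critNorm, (hv.memLp g (critExp n)).eLpNorm_eq_integral_rpow_norm (by simpa using hq) (by simp),
    ENNReal.toReal_ofReal hq.le, ENNReal.toReal_ofReal (by positivity), Real.rpow_inv_rpow h0 hq.ne']

theorem critNorm_add_rpow (hn : 3 ≤ n) {v w : M → ℝ} (hv : IsSmoothCompact n v)
    (hw : IsSmoothCompact n w) (h : Disjoint (tsupport v) (tsupport w)) (g : Metric n M) :
    critNorm g (v + w) ^ (2 * (n : ℝ) / (n - 2)) =
      critNorm g v ^ (2 * (n : ℝ) / (n - 2)) + critNorm g w ^ (2 * (n : ℝ) / (n - 2)) := by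
  have hq := critExp_real_pos hn
  have hi : ∀ {v : M → ℝ}, IsSmoothCompact n v →
      Integrable (fun x => ‖v x‖ ^ (2 * (n : ℝ) / (n - 2))) (riemannianVolume g) := by
    intro v hv
    have := (hv.memLp g (critExp n)).integrable_norm_rpow (by simpa using hq) (by simp)
    rwa [ENNReal.toReal_ofReal hq.le] at this
  rw [(hv.add hw).critNorm_rpow hn, hv.critNorm_rpow hn, hw.critNorm_rpow hn,
    ← integral_add (hi hv) (hi hw)]
  refine integral_congr_ae (Eventually.of_forall fun x => ?_)
  rcases eventuallyEq_add_of_disjoint_tsupport h x with ⟨h1, h2⟩ | ⟨h1, h2⟩ <;>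
    simp only [h1.self_of_nhds, h2.self_of_nhds] <;> simp [Real.zero_rpow hq.ne']

variable [T2Space M]

theorem energy_add {v w : M → ℝ} (hv : IsSmoothCompact n v)
    (hw : IsSmoothCompact n w) (h : Disjoint (tsupport v) (tsupport w)) (g : Metric n M) :
    energy g (v + w) = energy g v + energy g w := by
  rw [energy, energy, energy,
    ← integral_add (hv.integrable_energyDensity g) (hw.integrable_energyDensity g)]
  refine integral_congr_ae (Eventually.of_forall fun x => ?_)
  have h0 : energyDensity g (0 : M → ℝ) x = 0 := energyDensity_eq_zero g (by simp)
  rcases eventuallyEq_add_of_disjoint_tsupport h x with ⟨h1, h2⟩ | ⟨h1, h2⟩ <;>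
    simp [energyDensity_congr g h1, energyDensity_congr g h2, h0]

theorem exists_isTestFunction_sum (hn : 3 ≤ n) {g : Metric n M} {c : ℝ} (hc : 0 ≤ c)
    (H : ∀ L : Set M, IsCompact L → ∃ v, IsTestFunction n Lᶜ v ∧ functional g v < -c) (m : ℕ) :
    ∀ L : Set M, IsCompact L → ∃ v, IsTestFunction n Lᶜ v ∧ energy g v ≤ -c * (m + 1) ∧
      critNorm g v ^ (2 * (n : ℝ) / (n - 2)) = m + 1 := by
  induction m with
  | zero =>
    intro L hL
    obtain ⟨v, hv, hvc⟩ := H L hL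
    obtain ⟨w, hw, hwe, hwn⟩ := hv.exists_normalized hc hvc
    exact ⟨w, hw, by simpa using hwe, by simp [hwn]⟩
  | succ m ih =>
    intro L hL
    obtain ⟨v, hv, hve, hvn⟩ := ih L hL
    -- The support built so far is compact, so the next function can be placed outside it; index `m`
    -- stands for `m + 1` summands.
    obtain ⟨w₀, hw₀, hwc⟩ := H (L ∪ tsupport v) (hL.union hv.hasCompactSupport)
    obtain ⟨w, hw, hwe, hwn⟩ := hw₀.exists_normalized hc hwc
    have hd : Disjoint (tsupport v) (tsupport w) :=
      disjoint_right.2 fun x hx hx' => hw.tsupport_subset hx (Or.inr hx')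
    refine ⟨v + w, hv.add (hw.mono (compl_subset_compl.2 subset_union_left)), ?_, ?_⟩
    · rw [energy_add hv.isSmoothCompact hw.isSmoothCompact hd]
      push_cast
      linarith
    · rw [critNorm_add_rpow hn hv.isSmoothCompact hw.isSmoothCompact hd, hvn, hwn]
      simp

theorem exists_functional_lt (hn : 3 ≤ n) {g : Metric n M} {c : ℝ} (hc : 0 < c)
    (H : ∀ L : Set M, IsCompact L → ∃ v, IsTestFunction n Lᶜ v ∧ functional g v < -c)
    {L : Set M} (hL : IsCompact L) (R : ℝ) :
    ∃ v, IsTestFunction n Lᶜ v ∧ functional g v < R := by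
  have h2 := two_lt_cast hn
  have hq := critExp_real_pos hn
  have ht : Tendsto (fun m : ℕ => ((m : ℝ) + 1) ^ (2 / (n : ℝ))) atTop atTop :=
    (tendsto_rpow_atTop (by positivity)).comp
      (tendsto_atTop_add_const_right _ _ tendsto_natCast_atTop_atTop)
  obtain ⟨m, hm⟩ := (ht.eventually_gt_atTop (-R / c)).exists
  obtain ⟨v, hv, hve, hvn⟩ := exists_isTestFunction_sum hn hc.le H m L hL
  refine ⟨v, hv, ?_⟩
  have hm1 : (0 : ℝ) < m + 1 := by positivity
  -- The exponent is `2/p = (n-2)/n`; the remaining factor `(m+1)^(2/n)` of the energy bound was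
  -- made larger than `-R/c` by the choice of `m`.
  have hN : critNorm g v ^ 2 = ((m : ℝ) + 1) ^ (((n : ℝ) - 2) / n) := by
    rw [← hvn, ← Real.rpow_mul (critNorm_nonneg g v), ← Real.rpow_natCast]
    congr 1
    have : (n : ℝ) - 2 ≠ 0 := by linarith
    field_simp
    norm_num
  have hsplit : ((m : ℝ) + 1) ^ (2 / (n : ℝ)) * ((m : ℝ) + 1) ^ (((n : ℝ) - 2) / n) = m + 1 := by
    rw [← Real.rpow_add hm1]
    have : 2 / (n : ℝ) + ((n : ℝ) - 2) / n = 1 := by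
      field_simp
      ring
    rw [this, Real.rpow_one]
  have hNpos : 0 < ((m : ℝ) + 1) ^ (((n : ℝ) - 2) / n) := Real.rpow_pos_of_pos hm1 _
  rw [functional_eq, hN, div_lt_iff₀ hNpos]
  refine hve.trans_lt ?_
  rw [show -c * ((m : ℝ) + 1) = -c * ((m : ℝ) + 1) ^ (2 / (n : ℝ)) *
    ((m : ℝ) + 1) ^ (((n : ℝ) - 2) / n) by rw [mul_assoc, hsplit]]
  refine mul_lt_mul_of_pos_right ?_ hNpos
  rw [div_lt_iff₀ hc] at hm
  linarith

/-- A negative Yamabe constant at infinity is `-∞`. -/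
theorem yamabeConstantAtInfinity_eq_bot_of_neg (hn : 3 ≤ n) (g : Metric n M)
    (K : CompactExhaustion M) (h : yamabeConstantAtInfinity g K < 0) :
    yamabeConstantAtInfinity g K = ⊥ := by
  obtain ⟨c, hc, hc0⟩ := EReal.lt_iff_exists_real_btwn.1 h
  have hc0' : c < 0 := by exact_mod_cast hc0
  have H : ∀ L : Set M, IsCompact L → ∃ v, IsTestFunction n Lᶜ v ∧ functional g v < -(-c) := by
    intro L hL
    -- The constants of the exteriors increase to their limit, so each of them is below `c`.
    obtain ⟨i, hi⟩ := K.exists_superset_of_isCompact hL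
    have hlt := ((monotone_yamabeConstantOn_compl g K).ge_of_tendsto
      (tendsto_yamabeConstantAtInfinity g K) i).trans_lt hc
    simp only [yamabeConstantOn, iInf_lt_iff] at hlt
    obtain ⟨v, hv, hvc⟩ := hlt
    exact ⟨v, hv.mono (compl_subset_compl.2 hi), by simpa using hvc⟩
  have hbot : ∀ i, yamabeConstantOn g (K i)ᶜ = ⊥ := by
    intro i
    rw [EReal.eq_bot_iff_forall_lt]
    intro R
    obtain ⟨v, hv, hvR⟩ := exists_functional_lt hn (neg_pos.2 hc0') H (K.isCompact i) R
    exact (iInf₂_le v hv).trans_lt (by exact_mod_cast hvR)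
  refine tendsto_nhds_unique (tendsto_yamabeConstantAtInfinity g K) ?_
  simp [hbot]

end DisjointSupports

/-! ### Trigonometric cutoff: an exterior bound implies a global bound -/

section Cutoff

variable {n : ℕ} {M : Type*} [TopologicalSpace M]
  [ChartedSpace (EuclideanSpace ℝ (Fin n)) M]

theorem IsSmoothCompact.mul_left {v f : M → ℝ} (hv : IsSmoothCompact n v)
    (hf : ContMDiff (𝓡 n) 𝓘(ℝ, ℝ) ∞ f) : IsSmoothCompact n (fun x => f x * v x) :=
  ⟨hf.mul hv.smooth, hv.hasCompactSupport.mul_left⟩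

variable [IsManifold (𝓡 n) ∞ M] [MeasurableSpace M] [BorelSpace M]

theorem critNorm_mul_le {v f : M → ℝ} (hv : IsSmoothCompact n v) (hf : ∀ x, |f x| ≤ 1)
    (g : Metric n M) : critNorm g (fun x => f x * v x) ≤ critNorm g v := by
  refine ENNReal.toReal_mono (hv.memLp g _).2.ne (eLpNorm_mono fun x => ?_)
  rw [Real.norm_eq_abs, abs_mul, Real.norm_eq_abs]
  exact mul_le_of_le_one_left (abs_nonneg _) (hf x)

variable [T2Space M]

/-- Since `sin² + cos² = 1`, the zeroth-order terms add up exactly and the mixed gradient terms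
cancel. The localization error contains no derivative of `v`. -/
theorem energy_eq_sin_add_cos {v f : M → ℝ} (hv : IsSmoothCompact n v)
    (hf : ContMDiff (𝓡 n) 𝓘(ℝ, ℝ) ∞ f) (g : Metric n M) :
    energy g v = energy g (fun x => Real.sin (f x) * v x) +
      energy g (fun x => Real.cos (f x) * v x) -
      dirichletCoeff n * ∫ x, normDiff g f x ^ 2 * v x ^ 2 ∂(riemannianVolume g) := by
  have hs := hv.mul_left (Real.contDiff_sin.contMDiff.comp hf)
  have hc := hv.mul_left (Real.contDiff_cos.contMDiff.comp hf)
  rw [energy, energy, energy, ← integral_const_mul, ← integral_add, ← integral_sub]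
  · refine integral_congr_ae (Eventually.of_forall fun x => ?_)
    simp only [energyDensity]
    linear_combination (-dirichletCoeff n) * normDiff_sin_cos g hv.smooth hf x -
      scal g x * v x ^ 2 * Real.sin_sq_add_cos_sq (f x)
  · exact (hs.integrable_energyDensity g).add (hc.integrable_energyDensity g)
  · exact (hv.integrable_mul_sq g (continuous_normDiff_sq g hf)).const_mul _
  · exact hs.integrable_energyDensity g
  · exact hc.integrable_energyDensity g

/-- A lower bound of the functional on test functions gives a lower bound of the energy. -/
theorem neg_mul_critNorm_sq_le_energy_of_functional (hn : 3 ≤ n) {g : Metric n M} {U : Set M}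
    {C : ℝ} (hC : ∀ w, IsTestFunction n U w → -C ≤ functional g w) {w : M → ℝ}
    (hw : IsSmoothCompact n w) (hw0 : ∀ x, 0 ≤ w x) (hU : tsupport w ⊆ U) :
    -C * critNorm g w ^ 2 ≤ energy g w := by
  rcases (critNorm_nonneg g w).eq_or_lt with h0 | h0
  -- A cut-off function may vanish identically and then is not a test function. If its norm is zero,
  -- it vanishes almost everywhere, so its curvature term is zero and its energy is nonnegative.
  · have hz : eLpNorm w (critExp n) (riemannianVolume g) = 0 :=
      ((ENNReal.toReal_eq_zero_iff _).1 h0.symm).resolve_right (hw.memLp g _).2.ne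
    rw [eLpNorm_eq_zero_iff (hw.memLp g (critExp n)).1
      (by simpa using critExp_real_pos hn)] at hz
    have hi : ∫ x, scalNeg g x * w x ^ 2 ∂(riemannianVolume g) = 0 :=
      integral_eq_zero_of_ae (hz.mono fun x hx => by simp [hx])
    have := hw.neg_integral_scalNeg_le_energy hn g
    rw [← h0]
    simpa [hi] using this
  · have hne : w ≠ 0 := by
      rintro rfl
      simp [critNorm] at h0
    have := hC w ⟨hw.smooth, hw.hasCompactSupport, hU, hw0, hne⟩
    rwa [functional_eq, le_div_iff₀ (by positivity)] at this

theorem exists_bound_of_exterior_bound (hn : 3 ≤ n) {g : Metric n M} {L : Set M} {C : ℝ}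
    (hC0 : 0 ≤ C) (hC : ∀ w, IsTestFunction n Lᶜ w → -C ≤ functional g w) {f : M → ℝ}
    (hf : ContMDiff (𝓡 n) 𝓘(ℝ, ℝ) ∞ f) (hfc : HasCompactSupport f)
    (hf1 : ∀ x ∈ L, f =ᶠ[𝓝 x] fun _ => 1) (hf01 : ∀ x, f x ∈ Icc (0 : ℝ) 1) :
    ∃ B : ℝ, ∀ v, IsTestFunction n univ v → -B ≤ functional g v := by
  -- With this scaling `cos F` vanishes where `f = 1`, `sin F` vanishes where `f = 0`, and `cos F ≥
  -- 0` keeps the exterior part nonnegative.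
  set F : M → ℝ := fun x => Real.pi / 2 * f x
  have hF : ContMDiff (𝓡 n) 𝓘(ℝ, ℝ) ∞ F := contMDiff_const.mul hf
  have hFc : HasCompactSupport F := hfc.mul_left
  have hF0 : ∀ x, F x ∈ Icc 0 (Real.pi / 2) := fun x =>
    ⟨mul_nonneg (by positivity) (hf01 x).1, mul_le_of_le_one_right (by positivity) (hf01 x).2⟩
  -- Moving `sin²` into the weight makes it compactly supported, hence in `L^(n/2)`, even if
  -- `scalNeg g` is not; Hölder then applies to `v` itself.
  set h₁ : M → ℝ := fun x => scalNeg g x * Real.sin (F x) ^ 2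
  set h₂ : M → ℝ := fun x => normDiff g F x ^ 2
  have hc₁ : Continuous h₁ :=
    (continuous_scalNeg g).mul ((Real.continuous_sin.comp hF.continuous).pow 2)
  have hc₂ : Continuous h₂ := continuous_normDiff_sq g hF
  have hm₁ : MemLp h₁ ((n : ℝ≥0∞) / 2) (riemannianVolume g) :=
    hc₁.memLp_of_hasCompactSupport (HasCompactSupport.intro hFc fun x hx => by
      simp [h₁, image_eq_zero_of_notMem_tsupport hx])
  have hm₂ : MemLp h₂ ((n : ℝ≥0∞) / 2) (riemannianVolume g) :=
    hc₂.memLp_of_hasCompactSupport (HasCompactSupport.intro hFc fun x hx => by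
      simp [h₂, normDiff_eq_zero g hx])
  set N₁ := (eLpNorm h₁ ((n : ℝ≥0∞) / 2) (riemannianVolume g)).toReal
  set N₂ := (eLpNorm h₂ ((n : ℝ≥0∞) / 2) (riemannianVolume g)).toReal
  have hN₁ : 0 ≤ N₁ := ENNReal.toReal_nonneg
  have hN₂ : 0 ≤ N₂ := ENNReal.toReal_nonneg
  have ha := (dirichletCoeff_pos hn).le
  refine ⟨N₁ + C + dirichletCoeff n * N₂, fun v hv => neg_le_functional (by positivity) ?_⟩
  have hvs := hv.isSmoothCompact
  have hs := hvs.mul_left (Real.contDiff_sin.contMDiff.comp hF)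
  have hc := hvs.mul_left (Real.contDiff_cos.contMDiff.comp hF)
  have b₁ : -(N₁ * critNorm g v ^ 2) ≤ energy g (fun x => Real.sin (F x) * v x) := by
    refine le_trans (neg_le_neg ?_) (hs.neg_integral_scalNeg_le_energy hn g)
    refine le_trans (le_of_eq ?_) (integral_mul_sq_le hn
      (fun x => mul_nonneg (scalNeg_nonneg g x) (sq_nonneg _)) hm₁.1 hm₁.2.ne (hvs.memLp g _))
    refine integral_congr_ae (Eventually.of_forall fun x => ?_)
    simp only [h₁, Function.comp_apply]
    ring
  have hcos0 : ∀ x, 0 ≤ Real.cos (F x) := fun x =>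
    Real.cos_nonneg_of_mem_Icc ⟨by linarith [(hF0 x).1, Real.pi_pos], (hF0 x).2⟩
  -- The closed support avoids `L` only because `f = 1` on a neighbourhood of each point of `L`.
  have hsupp : tsupport (fun x => Real.cos (F x) * v x) ⊆ Lᶜ := by
    intro x hx hxL
    refine notMem_tsupport_iff_eventuallyEq.2 ?_ hx
    filter_upwards [hf1 x hxL] with z hz
    simp [F, hz]
  have b₂ := neg_mul_critNorm_sq_le_energy_of_functional hn hC hc
    (fun x => mul_nonneg (hcos0 x) (hv.nonneg x)) hsupp
  have b₃ : critNorm g (fun x => Real.cos (F x) * v x) ^ 2 ≤ critNorm g v ^ 2 :=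
    pow_le_pow_left₀ (critNorm_nonneg g _)
      (critNorm_mul_le hvs (fun x => Real.abs_cos_le_one _) g) 2
  have b₄ : ∫ x, h₂ x * v x ^ 2 ∂(riemannianVolume g) ≤ N₂ * critNorm g v ^ 2 :=
    integral_mul_sq_le hn (fun x => sq_nonneg _) hm₂.1 hm₂.2.ne (hvs.memLp g _)
  have b₅ := mul_le_mul_of_nonneg_left b₃ hC0
  have b₆ := mul_le_mul_of_nonneg_left b₄ ha
  rw [energy_eq_sin_add_cos hvs hF g]
  change _ ≤ _ - dirichletCoeff n * ∫ x, h₂ x * v x ^ 2 ∂(riemannianVolume g)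
  simp only [Function.comp_apply] at b₂
  linarith

variable [SecondCountableTopology M]

/-- If the Yamabe constant is `-∞`, then so is the Yamabe constant at infinity. -/
theorem yamabeConstantAtInfinity_eq_bot (hn : 3 ≤ n) (g : Metric n M) (K : CompactExhaustion M)
    (h : yamabeConstant g = ⊥) : yamabeConstantAtInfinity g K = ⊥ := by
  have : LocallyCompactSpace M := ChartedSpace.locallyCompactSpace (EuclideanSpace ℝ (Fin n)) M
  by_contra hne
  -- By the dichotomy for negative values, a constant at infinity other than `-∞` is nonnegative;
  -- `-1` is then an arbitrary strict lower bound.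
  have h0 : 0 ≤ yamabeConstantAtInfinity g K := by
    by_contra hlt
    exact hne (yamabeConstantAtInfinity_eq_bot_of_neg hn g K (not_le.1 hlt))
  have hlt : ((-1 : ℝ) : EReal) < yamabeConstantAtInfinity g K :=
    lt_of_lt_of_le (by exact_mod_cast neg_one_lt_zero) h0
  obtain ⟨i, hi⟩ := ((tendsto_yamabeConstantAtInfinity g K).eventually_const_lt hlt).exists
  have hC : ∀ w, IsTestFunction n (K i)ᶜ w → -1 ≤ functional g w := fun w hw => by
    exact_mod_cast hi.le.trans (iInf₂_le w hw)
  obtain ⟨f, hf1, hf0, hf01⟩ := exists_contMDiffMap_one_nhds_of_subset_interior (n := (⊤ : ℕ∞)) (𝓡 n)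
    (K.isCompact i).isClosed (K.subset_interior_succ i)
  obtain ⟨B, hB⟩ := exists_bound_of_exterior_bound hn zero_le_one hC f.contMDiff
    (HasCompactSupport.intro (K.isCompact (i + 1)) hf0)
    (fun x hx => hf1.filter_mono (nhds_le_nhdsSet hx)) hf01
  have hle : ((-B : ℝ) : EReal) ≤ yamabeConstant g :=
    le_iInf₂ fun v hv => by exact_mod_cast hB v hv
  rw [h, le_bot_iff] at hle
  exact EReal.coe_ne_bot _ hle

end Cutoff

end Yamabe

end

theorem mainTheorem4 (n : ℕ) (hn : 3 ≤ n) (M : Type*) [TopologicalSpace M]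
    [T2Space M] [SecondCountableTopology M] [NoncompactSpace M]
    [ChartedSpace (EuclideanSpace ℝ (Fin n)) M] [IsManifold (𝓡 n) ∞ M]
    [MeasurableSpace M] [BorelSpace M]
    (g : Yamabe.Metric n M) (K : CompactExhaustion M) :
    (-((eLpNorm (Yamabe.scalNeg g) ((n : ℝ≥0∞) / 2) (Yamabe.riemannianVolume g) : ℝ≥0∞) : EReal)
        ≤ Yamabe.yamabeConstant g ∧
      Yamabe.yamabeConstant g ≤ Yamabe.yamabeConstantAtInfinity g K) ∧
    (Yamabe.yamabeConstantAtInfinity g K < 0 → Yamabe.yamabeConstantAtInfinity g K = ⊥) ∧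
    (Yamabe.yamabeConstant g = ⊥ → Yamabe.yamabeConstantAtInfinity g K = ⊥) :=
  ⟨⟨Yamabe.neg_eLpNorm_scalNeg_le_yamabeConstant hn g,
    Yamabe.yamabeConstant_le_atInfinity g K⟩,
    Yamabe.yamabeConstantAtInfinity_eq_bot_of_neg hn g K,
    Yamabe.yamabeConstantAtInfinity_eq_bot hn g K⟩
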